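/- Work in $L^2(\mathbb{R})$ (complex valued). For $\gamma=(x,\omega)\in\mathbb{R}^2$ let $\pi(\gamma)\phi(t)=e^{2\pi i\omega t}\phi(t-x)$, let $\mathcal V_\phi f(\gamma)=\langle f,\pi(\gamma)\phi\rangle$, and for an integrable symbol $m:\mathbb{R}^2\to\mathbb{R}$ let $H_{m,\phi}f=\int_{\mathbb{R}^2}m(\gamma)\,\mathcal V_\phi f(\gamma)\,\pi(\gamma)\phi\,d\gamma$. For $L,R>0$ let $\varphi_{0,L}(t)=2^{1/4}\sqrt L\,e^{-\pi(Lt)^2}$ be the dilated Gaussian, let $h_{k,L}(t)=\sqrt L\,h_k(Lt)$, $k=0,1,2,\dots$, be the dilated Hermite functions, where $h_k(s)=2^{1/4}(k!)^{-1/2}\,\mathrm{He}_k(2\sqrt\pi s)\,e^{-\pi s^2}$ and $\mathrm{He}_k(x)=(-1)^ke^{x^2/2}\frac{d^k}{dx^k}e^{-x^2/2}$, let $\mathbb{E}_{L,R}=\{(x,\omega): L^2x^2+\omega^2/L^2\le R^2\}$, and let $\lambda_k(R)=1-e^{-\pi R^2}\sum_{j=0}^k\frac{(\pi R^2)^j}{j!}$.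 For finitely many families $\{\phi^j_k\}_{k\in K}$, $j=1,\dots,M$, and $\Gamma\subset\mathbb{R}^2$, the multi-window Gabor systems $\{\pi(\gamma)\phi^j_k\}_{\gamma\in\Gamma,k\in K}$ are called woven frames if each of them is a frame and, for every partition $\{\sigma_j\}_{j=1}^M$ of $\Gamma$ (empty parts allowed), the system $\{\pi(\gamma)\phi^j_k : 1\le j\le M,\ \gamma\in\sigma_j,\ k\in K\}$ is a frame for $L^2(\mathbb{R})$. Let $L_1,L_2>0$. Then: (1) $\|\varphi_{0,L_1}-\varphi_{0,L_2}\|_2^2=2-2\frac{\sqrt{2L_1L_2}}{\sqrt{L_1^2+L_2^2}}$, and $\|\varphi_{0,L_1}-\varphi_{0,L_2}\|_2<\frac12$ if and only if $\frac{64-\sqrt{1695}}{49}<\frac{L_2}{L_1}<\frac{64+\sqrt{1695}}{49}$. (2) For $i=1,2$, $(h_{k,L_i})_{k\ge0}$ is an orthonormal basis of $L^2(\mathbb{R})$, and for all $R>0$ and $\gamma\in\mathbb{R}^2$ the eigenfunctions of $H_{\chi_{\gamma+\mathbb{E}_{L_i,R}},\varphi_{0,L_i}}$ are precisely the nonzero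 multiples of the functions $\pi(\gamma)h_{k,L_i}$, $k\ge0$, with eigenvalues $\lambda_k(R)$. (3) Suppose $\frac{64-\sqrt{1695}}{49}<\frac{L_2}{L_1}<\frac{64+\sqrt{1695}}{49}$. Let $\Gamma\subset\mathbb{R}^2$ and $R>0$ be such that, for $i=1,2$, there are constants $0<A\le B<\infty$ with $A\le\sum_{\gamma\in\Gamma}\chi_{\gamma+\mathbb{E}_{L_i,R}}(z)\le B$ for all $z\in\mathbb{R}^2$. Then (a) there is $\varepsilon_0>0$ such that, for every $0<\varepsilon\le\varepsilon_0$, the set $\{k:\lambda_k(R)>\varepsilon\}$ is finite and the two multi-window Gabor systems $\{\pi(\gamma)h_{k,L_i}:\gamma\in\Gamma,\ \lambda_k(R)>\varepsilon\}$, $i=1,2$ (by (2), the eigenfunctions of the operators $H_{\chi_{\gamma+\mathbb{E}_{L_i,R}},\varphi_{0,L_i}}$, $\gamma\in\Gamma$, with eigenvalues larger than $\varepsilon$), are woven frames; (b) there is $N$ such that, for every $n\ge N$, the two multi-window Gabor systems $\{\pi(\gamma)h_{k,L_i}:\gamma\in\Gamma,\ 0\le k<n\}$, $i=1,2$, are woven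 frames. -/

import Mathlib

open MeasureTheory Complex

noncomputable section

/-- The Hilbert space `L²(ℝ)` of complex-valued functions (Lebesgue measure). -/
abbrev L2R : Type := Lp ℂ 2 (volume : Measure ℝ)

theorem memLp_tfShift (γ : ℝ × ℝ) (φ : L2R) :
    MemLp (fun t : ℝ => cexp (2 * Real.pi * I * γ.2 * t) * φ (t - γ.1)) 2 volume := by
  have h1 : MemLp (fun t : ℝ => φ (t - γ.1)) 2 volume :=
    (Lp.memLp φ).comp_measurePreserving (measurePreserving_sub_right volume γ.1)
  have hm : AEStronglyMeasurable
      (fun t : ℝ => cexp (2 * Real.pi * I * γ.2 * t) * φ (t - γ.1)) volume :=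
    (Continuous.aestronglyMeasurable (by fun_prop)).mul h1.1
  refine h1.of_le hm (Filter.Eventually.of_forall fun t => ?_)
  have : (2 * Real.pi * I * γ.2 * t : ℂ) = ((2 * Real.pi * γ.2 * t : ℝ) : ℂ) * I := by
    push_cast; ring
  rw [norm_mul, this, norm_exp_ofReal_mul_I, one_mul]

/-- The time-frequency shift `π(x, ω) φ (t) = exp (2 π i ω t) φ (t - x)` on `L²(ℝ)`. -/
def tfShift (γ : ℝ × ℝ) (φ : L2R) : L2R :=
  MemLp.toLp (fun t : ℝ => cexp (2 * Real.pi * I * γ.2 * t) * φ (t - γ.1)) (memLp_tfShift γ φ)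

/-- The short-time Fourier transform `V_φ f (γ) = ⟨f, π(γ) φ⟩`, linear in `f`
(Mathlib's inner product is linear in its second argument). -/
def stft (φ f : L2R) (γ : ℝ × ℝ) : ℂ := inner ℂ (tfShift γ φ) f

/-- The time-frequency localization operator
`H_{m,φ} f = ∫ V_φ f (γ) m(γ) π(γ) φ dγ`, as a Bochner integral in `L²(ℝ)`.
The integral converges absolutely for every (measurable) integrable symbol `m`,
because `V_φ f` is bounded. -/
def localizationOp (m : ℝ × ℝ → ℝ) (φ f : L2R) : L2R :=
  ∫ γ : ℝ × ℝ, (stft φ f γ * (m γ : ℂ)) • tfShift γ φ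

/-- `(e i)` is a frame: `A ‖f‖² ≤ ∑ |⟨f, e i⟩|² ≤ B ‖f‖²` for all `f`. -/
def IsFrame {ι : Type*} (e : ι → L2R) : Prop :=
  ∃ A B : ℝ, 0 < A ∧ A ≤ B ∧ ∀ f : L2R,
    Summable (fun i => ‖inner ℂ f (e i)‖ ^ 2) ∧
    A * ‖f‖ ^ 2 ≤ ∑' i, ‖inner ℂ f (e i)‖ ^ 2 ∧
    ∑' i, ‖inner ℂ f (e i)‖ ^ 2 ≤ B * ‖f‖ ^ 2

/-- The multi-window Gabor system `{π(γ) φ_k | γ ∈ Γ, k ∈ K}`. -/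
def gaborSystem {K : Type*} (φ : K → L2R) (Γ : Set (ℝ × ℝ)) : Γ × K → L2R :=
  fun p => tfShift p.1 (φ p.2)

/-- The systems `G({φ_k^j}_k, Γ)`, `j ∈ J`, are multi-window Gabor frames and they are woven:
for every partition `(σ_j)` of `Γ` (parts may be empty), the union over `j` of the systems
`G({φ_k^j}_k, σ_j)` is a frame. -/
def IsWoven {J K : Type*} (φ : J → K → L2R) (Γ : Set (ℝ × ℝ)) : Prop :=
  (∀ j, IsFrame (gaborSystem (φ j) Γ)) ∧
  ∀ σ : J → Set (ℝ × ℝ), Pairwise (fun i j => Disjoint (σ i) (σ j)) → ⋃ j, σ j = Γ →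
    IsFrame (fun p : Σ j, (σ j) × K => gaborSystem (φ p.1) (σ p.1) p.2)

/-- `∑_{γ ∈ Γ} η_γ ≈ 1`. -/
def SumApproxOne (Γ : Set (ℝ × ℝ)) (η : ℝ × ℝ → ℝ × ℝ → ℝ) : Prop :=
  ∃ A B : ℝ, 0 < A ∧ A ≤ B ∧ ∀ z : ℝ × ℝ,
    Summable (fun γ : Γ => η γ z) ∧ A ≤ ∑' γ : Γ, η γ z ∧ ∑' γ : Γ, η γ z ≤ B

/-- The ellipse `{(x, ω) | L² x² + ω² / L² ≤ R²}`. -/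
def ellipse (L R : ℝ) : Set (ℝ × ℝ) :=
  {z | L ^ 2 * z.1 ^ 2 + z.2 ^ 2 / L ^ 2 ≤ R ^ 2}

/-- The indicator function of the translated ellipse `γ + ellipse L R`. -/
def ellipseSymbol (L R : ℝ) (γ : ℝ × ℝ) : ℝ × ℝ → ℝ :=
  Set.indicator {z | z - γ ∈ ellipse L R} (fun _ => 1)

/-- `λ_k(R) = 1 - exp (-π R²) ∑_{j ≤ k} (π R²)^j / j!`. -/
def ellipseEigenvalue (R : ℝ) (k : ℕ) : ℝ :=
  1 - Real.exp (-(Real.pi * R ^ 2)) *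
    ∑ j ∈ Finset.range (k + 1), (Real.pi * R ^ 2) ^ j / (j.factorial : ℝ)

/-- The dilated standard Gaussian `2^{1/4} √L exp (-π (L t)²)`. -/
def dilatedGaussian (L : ℝ) (t : ℝ) : ℂ :=
  (((2 : ℝ) ^ (1 / 4 : ℝ) * √L * Real.exp (-(Real.pi * (L * t) ^ 2)) : ℝ) : ℂ)

/-- The `k`-th `L²`-normalized Hermite function dilated by `L`, i.e. `√L h_k(L t)` with
`h_k(s) = 2^{1/4} (k!)^{-1/2} He_k(2 √π s) exp (-π s²)`, where `He_k = Polynomial.hermite k`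
satisfies `He_k(x) = (-1)^k exp (x²/2) (d/dx)^k exp (-x²/2)`. -/
def dilatedHermite (L : ℝ) (k : ℕ) (t : ℝ) : ℂ :=
  (((2 : ℝ) ^ (1 / 4 : ℝ) * √L / √(k.factorial : ℝ) *
    Polynomial.aeval (2 * √Real.pi * (L * t)) (Polynomial.hermite k) *
    Real.exp (-(Real.pi * (L * t) ^ 2)) : ℝ) : ℂ)

theorem integrable_polynomial_mul_gaussian (P : Polynomial ℝ) {b : ℝ} (hb : 0 < b) :
    Integrable (fun t : ℝ => P.eval t * Real.exp (-b * t ^ 2)) volume := by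
  induction P using Polynomial.induction_on' with
  | add p q hp hq =>
    refine (hp.add hq).congr (Filter.Eventually.of_forall fun t => ?_)
    simp only [Pi.add_apply, Polynomial.eval_add, add_mul]
  | monomial n a =>
    have h := integrable_rpow_mul_exp_neg_mul_sq hb (s := (n : ℝ))
      (lt_of_lt_of_le (by norm_num) (Nat.cast_nonneg n))
    simp only [Real.rpow_natCast] at h
    simpa only [Polynomial.eval_monomial, mul_assoc] using h.const_mul a

theorem memLp_dilatedHermite {L : ℝ} (hL : 0 < L) (k : ℕ) :
    MemLp (dilatedHermite L k) 2 volume := by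
  have hc : Continuous (dilatedHermite L k) := by
    unfold dilatedHermite
    fun_prop
  rw [memLp_two_iff_integrable_sq_norm hc.aestronglyMeasurable]
  let Q : Polynomial ℝ := ((Polynomial.hermite k).map (Int.castRingHom ℝ)).comp
    (Polynomial.C (2 * √Real.pi * L) * Polynomial.X)
  have h := (integrable_polynomial_mul_gaussian (Q ^ 2) (b := 2 * Real.pi * L ^ 2)
    (by positivity)).const_mul (((2 : ℝ) ^ (1 / 4 : ℝ) * √L / √(k.factorial : ℝ)) ^ 2)
  refine h.congr (Filter.Eventually.of_forall fun t => ?_)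
  have hQ : Q.eval t = Polynomial.aeval (2 * √Real.pi * (L * t)) (Polynomial.hermite k) := by
    simp only [Q, Polynomial.eval_comp, Polynomial.eval_mul, Polynomial.eval_C,
      Polynomial.eval_X, Polynomial.eval_map, Polynomial.aeval_def, mul_assoc]
    rfl
  have he : Real.exp (-(2 * Real.pi * L ^ 2) * t ^ 2) =
      Real.exp (-(Real.pi * (L * t) ^ 2)) ^ 2 := by
    rw [← Real.exp_nat_mul]; congr 1; push_cast; ring
  simp only [dilatedHermite, Complex.norm_real, Real.norm_eq_abs, sq_abs, Polynomial.eval_pow,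
    hQ, he]
  ring

theorem dilatedHermite_zero (L : ℝ) : dilatedHermite L 0 = dilatedGaussian L := by
  funext t
  simp [dilatedHermite, dilatedGaussian]

/-- The dilated Hermite function as an element of `L²(ℝ)`. -/
def hermiteL2 (L : ℝ) (hL : 0 < L) (k : ℕ) : L2R :=
  MemLp.toLp (dilatedHermite L k) (memLp_dilatedHermite hL k)

/-- The dilated Gaussian as an element of `L²(ℝ)`. -/
def gaussianL2 (L : ℝ) (hL : 0 < L) : L2R :=
  MemLp.toLp (dilatedGaussian L) (dilatedHermite_zero L ▸ memLp_dilatedHermite hL 0)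

end

noncomputable section

/-! Moyal's identity, Plancherel applied to each time slice, turns `‖f‖²` into the energy of the
short-time Fourier transform over the plane (`lintegral_enorm_stft_sq`). With a Gaussian window the
transform of the `k`-th Hermite function is a phase times a radial weight times the `k`-th power of
a conjugate complex coordinate. Monomials are orthogonal on discs, so the ellipse operators are
diagonal in the shifted Hermite basis, and the energy of `f` on `γ + ellipse L R` is the sum of
`λ_k(R) |⟨f, π(γ) h_k⟩|²` (`tsum_ellipseEigenvalue_mul`). Completeness comes from the same formula:
the squared Hermite coefficients of a shifted Gaussian are Poisson weights with sum one.

For weaving, the ellipses of suitably enlarged radius around the points of `σ 0` and of `σ 1`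
together cover the plane. Keep the first window on the part `U 0` of the plane covered from `σ 0`
and switch to the second window on its complement. The switch costs at most `2 ‖φ - ψ‖² ‖f‖²`, less
than half of `‖f‖²` for nonzero `f` when the windows are closer than `1 / 2`
(`enorm_sq_le_four_mul_setLIntegral_stft`). Thus the local energies control `‖f‖²`.

Finitely many coefficients suffice because `λ_k(ρ)` is eventually an arbitrarily small multiple of
`λ_k(2ρ)`: the tail is a small part of the energy on doubled ellipses, whose total is `O(‖f‖²)` by
bounded overlap, and it is absorbed (`exists_le_tsum_hermiteEnergy`). The truncation order depends
neither on `f` nor on the partition. Upper frame bounds use that finitely many eigenvalues are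
bounded away from zero. -/

/-! ### Plancherel and Moyal's identity -/

open FourierTransform SchwartzMap in
/-- The Fourier integral of a function in `L¹ ∩ L²` represents its `L²` Fourier transform. -/
theorem fourier_toLp_ae_eq {u : ℝ → ℂ} (h1 : Integrable u) (h2 : MemLp u 2 volume) :
    (𝓕 (h2.toLp u) : L2R) =ᵐ[volume] 𝓕 u := by
  have hcont : Continuous (𝓕 u) :=
    VectorFourier.fourierIntegral_continuous Real.continuous_fourierChar
      (by exact continuous_inner) h1
  apply ae_eq_of_integral_contDiff_smul_eq
  · exact (Lp.memLp _).locallyIntegrable (by norm_num)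
  · exact hcont.locallyIntegrable
  · intro g g_smooth g_cpt
    have hg₁ : HasCompactSupport (Complex.ofRealCLM ∘ g) := g_cpt.comp_left rfl
    have hg₂ : ContDiff ℝ (⊤ : ℕ∞) (Complex.ofRealCLM ∘ g) :=
      Complex.ofRealCLM.contDiff.comp g_smooth
    set G : 𝓢(ℝ, ℂ) := hg₁.toSchwartzMap hg₂ with hG
    have hGg : ∀ x, G x = (g x : ℂ) := fun x => rfl
    -- Both candidates are tested against `G`: the `L²` transform passes to `G` by duality of
    -- tempered distributions, the Fourier integral by the multiplication formula `e2`.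
    have e1 := congrArg (fun T => T G) (Lp.fourier_toTemperedDistribution_eq (h2.toLp u))
    simp only [TemperedDistribution.fourier_apply, Lp.toTemperedDistribution_apply] at e1
    have e2 : ∫ ξ, (𝓕 (G : ℝ → ℂ) ξ) • u ξ = ∫ x, G x • 𝓕 u x := by
      have := VectorFourier.integral_fourierIntegral_smul_eq_flip (L := innerₗ ℝ) (μ := volume)
        (ν := volume) Real.continuous_fourierChar continuous_inner G.integrable h1
      rw [flip_innerₗ] at this
      exact this
    have e3 : ∀ x, g x • 𝓕 u x = G x • 𝓕 u x := fun x => by rw [hGg]; simp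
    have e4 : ∀ x, g x • (𝓕 (h2.toLp u) : L2R) x = G x • (𝓕 (h2.toLp u) : L2R) x :=
      fun x => by rw [hGg]; simp
    simp only [e3, e4]
    rw [← e1, ← e2]
    apply integral_congr_ae
    filter_upwards [h2.coeFn_toLp] with x hx
    rw [hx, SchwartzMap.fourier_coe]

theorem lintegral_enorm_sq_eq (f : L2R) : ∫⁻ t, ‖f t‖ₑ ^ 2 = ‖f‖ₑ ^ 2 := by
  rw [Lp.enorm_def, eLpNorm_eq_lintegral_rpow_enorm_toReal (by norm_num) (by norm_num)]
  simp only [ENNReal.toReal_ofNat, ENNReal.rpow_ofNat]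
  rw [← ENNReal.rpow_natCast, ← ENNReal.rpow_mul]
  simp

open FourierTransform in
/-- Plancherel's theorem for functions in `L¹ ∩ L²`. -/
theorem lintegral_enorm_fourier_sq {u : ℝ → ℂ} (h1 : Integrable u) (h2 : MemLp u 2 volume) :
    ∫⁻ ω, ‖𝓕 u ω‖ₑ ^ 2 = ∫⁻ t, ‖u t‖ₑ ^ 2 := by
  have e1 : ∫⁻ ω, ‖𝓕 u ω‖ₑ ^ 2 = ∫⁻ ω, ‖(𝓕 (h2.toLp u) : L2R) ω‖ₑ ^ 2 := by
    apply lintegral_congr_ae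
    filter_upwards [fourier_toLp_ae_eq h1 h2] with x hx
    rw [hx]
  have e2 : ∫⁻ ω, ‖u ω‖ₑ ^ 2 = ∫⁻ ω, ‖(h2.toLp u) ω‖ₑ ^ 2 := by
    apply lintegral_congr_ae
    filter_upwards [h2.coeFn_toLp] with x hx
    rw [hx]
  rw [e1, e2, lintegral_enorm_sq_eq, lintegral_enorm_sq_eq]
  congr 1
  rw [enorm_eq_iff_norm_eq]
  exact Lp.norm_fourier_eq _

theorem coeFn_tfShift (γ : ℝ × ℝ) (φ : L2R) :
    tfShift γ φ =ᵐ[volume] fun t : ℝ => cexp (2 * Real.pi * I * γ.2 * t) * φ (t - γ.1) :=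
  MemLp.coeFn_toLp _

theorem norm_exp_two_pi_I_mul (ω t : ℝ) : ‖cexp (2 * Real.pi * I * ω * t)‖ = 1 := by
  have : (2 * Real.pi * I * ω * t : ℂ) = ((2 * Real.pi * ω * t : ℝ) : ℂ) * I := by
    push_cast; ring
  rw [this, norm_exp_ofReal_mul_I]

theorem conj_exp_two_pi_I_mul (ω t : ℝ) : (starRingEnd ℂ) (cexp (2 * Real.pi * I * ω * t)) =
    cexp (-(2 * Real.pi * I * ω * t)) := by
  rw [← Complex.exp_conj]
  simp [Complex.conj_ofNat]

theorem memLp_sub_right (φ : L2R) (x : ℝ) : MemLp (fun t : ℝ => φ (t - x)) 2 volume :=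
  (Lp.memLp φ).comp_measurePreserving (measurePreserving_sub_right volume x)

theorem stft_eq_integral (φ f : L2R) (γ : ℝ × ℝ) :
    stft φ f γ = ∫ t : ℝ, cexp (-(2 * Real.pi * I * γ.2 * t)) *
      ((starRingEnd ℂ) (φ (t - γ.1)) * f t) := by
  rw [stft, L2.inner_def]
  apply integral_congr_ae
  filter_upwards [coeFn_tfShift γ φ] with t ht
  rw [ht]
  simp only [RCLike.inner_apply, map_mul, conj_exp_two_pi_I_mul]
  ring

/-- For fixed `x` the transform is an ordinary Fourier integral in `ω`, so Plancherel can be applied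
slice by slice. -/
theorem stft_eq_fourier (φ f : L2R) (x ω : ℝ) :
    stft φ f (x, ω) = FourierTransform.fourier
      (fun t : ℝ => (starRingEnd ℂ) (φ (t - x)) * f t) ω := by
  rw [stft_eq_integral, Real.fourier_real_eq_integral_exp_smul]
  congr 1 with t
  simp only [smul_eq_mul]
  congr 2
  push_cast
  ring

theorem stronglyMeasurable_stft (φ f : L2R) : StronglyMeasurable (stft φ f) := by
  have : stft φ f = fun γ => ∫ t : ℝ, cexp (-(2 * Real.pi * I * γ.2 * t)) *
      ((starRingEnd ℂ) (φ (t - γ.1)) * f t) := funext fun γ => stft_eq_integral φ f γ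
  rw [this]
  apply StronglyMeasurable.integral_prod_right (f := fun γ : ℝ × ℝ => fun t : ℝ =>
    cexp (-(2 * Real.pi * I * γ.2 * t)) * ((starRingEnd ℂ) (φ (t - γ.1)) * f t))
  have hφ := (Lp.stronglyMeasurable φ).measurable
  have hf := (Lp.stronglyMeasurable f).measurable
  have hc : Measurable (starRingEnd ℂ) := Complex.continuous_conj.measurable
  apply Measurable.stronglyMeasurable
  simp only [Function.uncurry_def]
  fun_prop

/-- Moyal's identity: the short-time Fourier transform preserves norms up to `‖φ‖`. -/
theorem lintegral_enorm_stft_sq (φ f : L2R) :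
    ∫⁻ z : ℝ × ℝ, ‖stft φ f z‖ₑ ^ 2 = ‖φ‖ₑ ^ 2 * ‖f‖ₑ ^ 2 := by
  have hφ := (Lp.stronglyMeasurable φ).measurable
  have hf := (Lp.stronglyMeasurable f).measurable
  have hm : Measurable (fun z => ‖stft φ f z‖ₑ ^ 2) :=
    ((stronglyMeasurable_stft φ f).measurable.enorm).pow_const 2
  have key : ∫⁻ x : ℝ, ∫⁻ t : ℝ, ‖(starRingEnd ℂ) (φ (t - x)) * f t‖ₑ ^ 2 =
      ‖φ‖ₑ ^ 2 * ‖f‖ₑ ^ 2 := by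
    have e : ∀ x t : ℝ, ‖(starRingEnd ℂ) (φ (t - x)) * f t‖ₑ ^ 2 =
        ‖φ (t - x)‖ₑ ^ 2 * ‖f t‖ₑ ^ 2 := fun x t => by
      rw [enorm_mul, mul_pow, RCLike.enorm_conj]
    simp only [e]
    rw [lintegral_lintegral_swap]
    · have : ∀ t : ℝ, ∫⁻ x, ‖φ (t - x)‖ₑ ^ 2 * ‖f t‖ₑ ^ 2 = ‖φ‖ₑ ^ 2 * ‖f t‖ₑ ^ 2 := by
        intro t
        rw [lintegral_mul_const _ (by fun_prop),
          lintegral_sub_left_eq_self (fun x => ‖φ x‖ₑ ^ 2) t, lintegral_enorm_sq_eq]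
      simp only [this]
      rw [lintegral_const_mul _ (by fun_prop), lintegral_enorm_sq_eq]
    · apply Measurable.aemeasurable
      simp only [Function.uncurry_def]
      fun_prop
  rw [Measure.volume_eq_prod, lintegral_prod _ hm.aemeasurable, ← key]
  -- A product of two `L²` functions is only integrable in general; finiteness of the double
  -- integral `key` makes almost every slice square integrable too, as Plancherel requires.
  have hfin : ∀ᵐ x : ℝ, ∫⁻ t : ℝ, ‖(starRingEnd ℂ) (φ (t - x)) * f t‖ₑ ^ 2 < ⊤ := by
    apply ae_lt_top
    · apply Measurable.lintegral_prod_right (f := fun x t : ℝ =>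
        ‖(starRingEnd ℂ) (φ (t - x)) * f t‖ₑ ^ 2)
      have hc : Measurable (starRingEnd ℂ) := Complex.continuous_conj.measurable
      simp only [Function.uncurry_def]
      fun_prop
    · rw [key]
      exact ENNReal.mul_ne_top (by simp) (by simp)
  apply lintegral_congr_ae
  filter_upwards [hfin] with x hx
  have hc : Measurable (starRingEnd ℂ) := Complex.continuous_conj.measurable
  have hmeas : AEStronglyMeasurable (fun t : ℝ => (starRingEnd ℂ) (φ (t - x)) * f t) volume := by
    apply Measurable.aestronglyMeasurable
    fun_prop
  have h1 : Integrable (fun t : ℝ => (starRingEnd ℂ) (φ (t - x)) * f t) :=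
    MemLp.integrable_mul (memLp_sub_right φ x).star (Lp.memLp f)
  have h2 : MemLp (fun t : ℝ => (starRingEnd ℂ) (φ (t - x)) * f t) 2 volume := by
    refine ⟨hmeas, ?_⟩
    rw [eLpNorm_lt_top_iff_lintegral_rpow_enorm_lt_top (by norm_num) (by norm_num)]
    simpa using hx
  simp only [stft_eq_fourier]
  exact lintegral_enorm_fourier_sq h1 h2

/-! ### Time-frequency shifts and covariance -/

theorem tfShift_add (γ : ℝ × ℝ) (f g : L2R) : tfShift γ (f + g) = tfShift γ f + tfShift γ g := by
  apply Lp.ext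
  have h := (measurePreserving_sub_right volume γ.1).quasiMeasurePreserving.ae_eq_comp
    (Lp.coeFn_add f g)
  filter_upwards [coeFn_tfShift γ (f + g), coeFn_tfShift γ f, coeFn_tfShift γ g,
    Lp.coeFn_add (tfShift γ f) (tfShift γ g), h] with t h1 h2 h3 h4 h5
  simp only [Function.comp_apply, Pi.add_apply] at h5
  rw [h1, h4, Pi.add_apply, h2, h3, h5, mul_add]

theorem tfShift_smul (γ : ℝ × ℝ) (c : ℂ) (f : L2R) : tfShift γ (c • f) = c • tfShift γ f := by
  apply Lp.ext
  have h := (measurePreserving_sub_right volume γ.1).quasiMeasurePreserving.ae_eq_comp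
    (Lp.coeFn_smul c f)
  filter_upwards [coeFn_tfShift γ (c • f), coeFn_tfShift γ f,
    Lp.coeFn_smul c (tfShift γ f), h] with t h1 h2 h4 h5
  simp only [Function.comp_apply, Pi.smul_apply, smul_eq_mul] at h5
  rw [h1, h4, Pi.smul_apply, h2, h5, smul_eq_mul, mul_left_comm]

theorem enorm_tfShift (γ : ℝ × ℝ) (f : L2R) : ‖tfShift γ f‖ₑ = ‖f‖ₑ := by
  have h : ‖tfShift γ f‖ₑ ^ 2 = ‖f‖ₑ ^ 2 := by
    rw [← lintegral_enorm_sq_eq, ← lintegral_enorm_sq_eq]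
    have : ∫⁻ t, ‖tfShift γ f t‖ₑ ^ 2 = ∫⁻ t, ‖f (t - γ.1)‖ₑ ^ 2 := by
      apply lintegral_congr_ae
      filter_upwards [coeFn_tfShift γ f] with t ht
      rw [ht, enorm_mul, ← ofReal_norm (cexp _), norm_exp_two_pi_I_mul]
      simp
    rw [this, lintegral_sub_right_eq_self (fun t => ‖f t‖ₑ ^ 2)]
  exact (ENNReal.pow_right_strictMono two_ne_zero).injective h

theorem norm_tfShift (γ : ℝ × ℝ) (f : L2R) : ‖tfShift γ f‖ = ‖f‖ :=
  enorm_eq_iff_norm_eq.mp (enorm_tfShift γ f)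

/-- The time-frequency shift as a linear isometry. -/
def tfShiftIsometry (γ : ℝ × ℝ) : L2R →ₗᵢ[ℂ] L2R where
  toFun := tfShift γ
  map_add' := tfShift_add γ
  map_smul' := tfShift_smul γ
  norm_map' := norm_tfShift γ

theorem inner_tfShift (γ : ℝ × ℝ) (f g : L2R) :
    inner ℂ (tfShift γ f) (tfShift γ g) = inner ℂ f g :=
  (tfShiftIsometry γ).inner_map_map f g

theorem tfShift_tfShift (γ z : ℝ × ℝ) (f : L2R) : tfShift γ (tfShift z f) =
    cexp (2 * Real.pi * I * (-z.2 : ℝ) * γ.1) • tfShift (γ + z) f := by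
  apply Lp.ext
  have h := (measurePreserving_sub_right volume γ.1).quasiMeasurePreserving.ae_eq_comp
    (coeFn_tfShift z f)
  filter_upwards [coeFn_tfShift γ (tfShift z f), coeFn_tfShift (γ + z) f,
    Lp.coeFn_smul (cexp (2 * Real.pi * I * (-z.2 : ℝ) * γ.1)) (tfShift (γ + z) f), h]
    with t h1 h2 h3 h4
  simp only [Function.comp_apply] at h4
  rw [h1, h3, Pi.smul_apply, h2, h4, smul_eq_mul, ← mul_assoc, ← mul_assoc, ← Complex.exp_add,
    ← Complex.exp_add, Prod.fst_add, Prod.snd_add, ← sub_sub]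
  congr 2
  push_cast
  ring

theorem tfShift_zero (f : L2R) : tfShift 0 f = f := by
  apply Lp.ext
  filter_upwards [coeFn_tfShift 0 f] with t h1
  rw [h1]
  simp

theorem tfShift_surjective (γ : ℝ × ℝ) : Function.Surjective (tfShift γ) := by
  intro f
  refine ⟨cexp (-(2 * Real.pi * I * γ.2 * γ.1)) • tfShift (-γ) f, ?_⟩
  rw [tfShift_smul, tfShift_tfShift, add_neg_cancel, tfShift_zero, smul_smul, ← Complex.exp_add]
  simp

/-- The short-time Fourier transform is covariant up to a phase of modulus one. -/
theorem stft_tfShift (φ f : L2R) (γ z : ℝ × ℝ) : stft φ (tfShift γ f) (γ + z) =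
    cexp (2 * Real.pi * I * (-z.2 : ℝ) * γ.1) * stft φ f z := by
  have h := congrArg (fun g => inner ℂ g (tfShift γ f)) (tfShift_tfShift γ z φ)
  simp only [inner_tfShift, inner_smul_left] at h
  rw [stft, stft, h, ← mul_assoc, RCLike.mul_conj, norm_exp_two_pi_I_mul]
  simp

theorem norm_stft_le (φ f : L2R) (z : ℝ × ℝ) : ‖stft φ f z‖ ≤ ‖φ‖ * ‖f‖ := by
  rw [stft, ← norm_tfShift z φ]
  exact norm_inner_le_norm _ _

theorem stft_sub_left (φ ψ f : L2R) (z : ℝ × ℝ) :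
    stft (φ - ψ) f z = stft φ f z - stft ψ f z := by
  have : tfShift z (φ - ψ) = tfShift z φ - tfShift z ψ := (tfShiftIsometry z).map_sub φ ψ
  rw [stft, stft, stft, this, inner_sub_left]

/-! ### Gaussian integrals of Hermite polynomials -/

/-- The integrand `P(y) exp (a y - y² / 2)`. -/
def polyGauss (P : Polynomial ℂ) (a : ℂ) (y : ℝ) : ℂ := P.eval (y : ℂ) * cexp (a * y - y ^ 2 / 2)

theorem continuous_polyGauss (P : Polynomial ℂ) (a : ℂ) : Continuous (polyGauss P a) := by
  unfold polyGauss
  have : Continuous fun y : ℝ => P.eval (y : ℂ) := P.continuous.comp continuous_ofReal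
  fun_prop

theorem integrable_polyGauss (P : Polynomial ℂ) (a : ℂ) : Integrable (polyGauss P a) := by
  induction P using Polynomial.induction_on' with
  | add p q hp hq =>
    refine (hp.add hq).congr (Filter.Eventually.of_forall fun t => ?_)
    simp only [polyGauss, Pi.add_apply, Polynomial.eval_add, add_mul]
  | monomial n c =>
    -- Since `a y ≤ a² + y² / 4` for real `a`, half of the Gaussian decay absorbs the linear
    -- exponent and `exp (-y² / 4)` remains as a majorant.
    have h := ((integrable_polynomial_mul_gaussian (Polynomial.X ^ n) (b := 1 / 4)
      (by norm_num)).norm.const_mul (‖c‖ * Real.exp (a.re ^ 2)))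
    refine h.mono' (continuous_polyGauss _ _).aestronglyMeasurable
      (Filter.Eventually.of_forall fun y => ?_)
    have e : (a * y - y ^ 2 / 2 : ℂ).re = a.re * y - y ^ 2 / 2 := by
      simp [← ofReal_pow]
    have hexp : Real.exp (a.re * y - y ^ 2 / 2) ≤
        Real.exp (a.re ^ 2) * Real.exp (-(1 / 4) * y ^ 2) := by
      rw [← Real.exp_add, Real.exp_le_exp]
      nlinarith [sq_nonneg (a.re - y / 2)]
    simp only [polyGauss, Polynomial.eval_monomial, norm_mul, norm_pow, Complex.norm_exp, e,
      Polynomial.eval_pow, Polynomial.eval_X, Complex.norm_real, Real.norm_eq_abs, Real.abs_exp]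
    calc ‖c‖ * |y| ^ n * Real.exp (a.re * y - y ^ 2 / 2)
        ≤ ‖c‖ * |y| ^ n * (Real.exp (a.re ^ 2) * Real.exp (-(1 / 4) * y ^ 2)) := by gcongr
      _ = _ := by ring

/-- The probabilists' Hermite polynomials with complex coefficients. -/
def hermiteC (k : ℕ) : Polynomial ℂ := (Polynomial.hermite k).map (Int.castRingHom ℂ)

theorem hermiteC_zero : hermiteC 0 = 1 := by simp [hermiteC]

theorem hermiteC_succ (k : ℕ) :
    hermiteC (k + 1) = Polynomial.X * hermiteC k - Polynomial.derivative (hermiteC k) := by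
  simp [hermiteC, Polynomial.hermite_succ, Polynomial.derivative_map]

theorem hasDerivAt_polyGauss (P : Polynomial ℂ) (a : ℂ) (y : ℝ) :
    HasDerivAt (polyGauss P a)
      (polyGauss (Polynomial.derivative P + (Polynomial.C a - Polynomial.X) * P) a y) y := by
  have h1 : HasDerivAt (fun y : ℝ => P.eval (y : ℂ)) ((Polynomial.derivative P).eval (y : ℂ)) y :=
    (P.hasDerivAt (y : ℂ)).comp_ofReal
  have h2 : HasDerivAt (fun y : ℂ => cexp (a * y - y ^ 2 / 2))
      (cexp (a * y - y ^ 2 / 2) * (a - y)) (y : ℂ) := by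
    have h3 : HasDerivAt (fun y : ℂ => a * y - y ^ 2 / 2) (a - y) (y : ℂ) := by
      have := ((hasDerivAt_id (y : ℂ)).const_mul a).sub (((hasDerivAt_id (y : ℂ)).pow 2).div_const 2)
      refine this.congr_deriv ?_
      simp
    exact h3.cexp
  refine (h1.mul h2.comp_ofReal).congr_deriv ?_
  simp only [polyGauss, Polynomial.eval_add, Polynomial.eval_mul, Polynomial.eval_sub,
    Polynomial.eval_C, Polynomial.eval_X]
  ring

/-- Integration by parts against a Hermite polynomial. -/
theorem integral_polyGauss_mul_hermiteC_succ (P : Polynomial ℂ) (a : ℂ) (k : ℕ) :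
    ∫ y, polyGauss (P * hermiteC (k + 1)) a y =
      ∫ y, polyGauss ((Polynomial.derivative P + Polynomial.C a * P) * hermiteC k) a y := by
  -- By `He_{k+1} = X He_k - He_k'`, the derivative of `P He_k exp (a y - y² / 2)` is exactly the
  -- difference of the two integrands.
  have h := integral_eq_zero_of_hasDerivAt_of_integrable
    (hasDerivAt_polyGauss (P * hermiteC k) a) (integrable_polyGauss _ _) (integrable_polyGauss _ _)
  rw [← sub_eq_zero, ← integral_sub (integrable_polyGauss _ _) (integrable_polyGauss _ _),
    ← neg_eq_zero, ← integral_neg, ← h]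
  congr 1 with y
  simp only [polyGauss, hermiteC_succ, Polynomial.eval_add, Polynomial.eval_mul,
    Polynomial.eval_sub, Polynomial.eval_C, Polynomial.eval_X, Polynomial.derivative_mul]
  ring

theorem integral_polyGauss_one (a : ℂ) :
    ∫ y, polyGauss 1 a y = (√(2 * Real.pi) : ℂ) * cexp (a ^ 2 / 2) := by
  have h := integral_cexp_quadratic (b := -(1 / 2)) (by norm_num) a 0
  have e1 : ((Real.pi : ℂ) / - -(1 / 2)) ^ (1 / 2 : ℂ) = (√(2 * Real.pi) : ℂ) := by
    rw [Real.sqrt_eq_rpow, ofReal_cpow (by positivity)]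
    push_cast
    congr 1
    ring
  rw [e1] at h
  calc _ = ∫ y : ℝ, cexp (-(1 / 2) * y ^ 2 + a * y + 0) := by
        congr 1 with y
        simp only [polyGauss, Polynomial.eval_one, one_mul]
        congr 1
        ring
    _ = _ := by rw [h]; congr 2; ring

/-- Against a constant, each integration by parts trades one Hermite degree for a factor `a`, down
to the plain Gaussian integral. This is the origin of the monomials in the transform of Hermite
functions. -/
theorem integral_polyGauss_hermiteC (a : ℂ) (k : ℕ) :
    ∫ y, polyGauss (hermiteC k) a y = a ^ k * ((√(2 * Real.pi) : ℂ) * cexp (a ^ 2 / 2)) := by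
  suffices H : ∀ c : ℂ, ∫ y, polyGauss (Polynomial.C c * hermiteC k) a y =
      c * a ^ k * ((√(2 * Real.pi) : ℂ) * cexp (a ^ 2 / 2)) by simpa using H 1
  induction k with
  | zero =>
    intro c
    rw [← integral_polyGauss_one, ← integral_const_mul]
    congr 1 with y
    simp [polyGauss, hermiteC_zero]
  | succ k ih =>
    intro c
    rw [integral_polyGauss_mul_hermiteC_succ, Polynomial.derivative_C, zero_add, ← Polynomial.C_mul,
      ih]
    ring

/-- At `a = 0` each integration by parts only differentiates `P`; counting degrees then gives
orthogonality and the norms. -/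
theorem integral_polyGauss_mul_hermiteC (P : Polynomial ℂ) (k : ℕ) :
    ∫ y, polyGauss (P * hermiteC k) 0 y = ∫ y, polyGauss (Polynomial.derivative^[k] P) 0 y := by
  induction k generalizing P with
  | zero => simp [hermiteC_zero]
  | succ k ih =>
    rw [integral_polyGauss_mul_hermiteC_succ, Polynomial.C_0, zero_mul, add_zero, ih,
      Function.iterate_succ_apply]

theorem natDegree_hermiteC (k : ℕ) : (hermiteC k).natDegree = k := by
  rw [hermiteC, Polynomial.natDegree_map_eq_of_injective (RingHom.injective_int _),
    Polynomial.natDegree_hermite]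

theorem iterate_derivative_hermiteC (k : ℕ) :
    Polynomial.derivative^[k] (hermiteC k) = Polynomial.C (k.factorial : ℂ) := by
  rw [Polynomial.eq_C_of_natDegree_eq_zero (p := Polynomial.derivative^[k] (hermiteC k))]
  · rw [Polynomial.coeff_iterate_derivative, zero_add, Nat.descFactorial_self, hermiteC,
      Polynomial.coeff_map, Polynomial.coeff_hermite_self]
    simp
  · have := Polynomial.natDegree_iterate_derivative (hermiteC k) k
    rw [natDegree_hermiteC] at this
    omega

theorem integral_polyGauss_hermiteC_mul_hermiteC (j k : ℕ) :
    ∫ y, polyGauss (hermiteC j * hermiteC k) 0 y =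
      if j = k then (k.factorial : ℂ) * (√(2 * Real.pi) : ℂ) else 0 := by
  have hlt : ∀ i l : ℕ, i < l → ∫ y, polyGauss (hermiteC i * hermiteC l) 0 y = 0 := by
    intro i l h
    rw [integral_polyGauss_mul_hermiteC,
      Polynomial.iterate_derivative_eq_zero (by rwa [natDegree_hermiteC])]
    simp [polyGauss]
  rcases lt_trichotomy j k with h | rfl | h
  · rw [if_neg h.ne, hlt j k h]
  · rw [if_pos rfl, integral_polyGauss_mul_hermiteC, iterate_derivative_hermiteC]
    have := integral_polyGauss_one 0
    simp only [ne_eq, OfNat.ofNat_ne_zero, not_false_eq_true, zero_pow, zero_div, Complex.exp_zero,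
      mul_one] at this
    rw [← this, ← integral_const_mul]
    congr 1 with y
    simp [polyGauss]
  · rw [if_neg h.ne', mul_comm, hlt k j h]

/-! ### Dilated Hermite functions and their transforms -/

/-- The frequency scale relating the dilated Hermite functions to the probabilists' Hermite
polynomials. -/
def hermiteScale (L : ℝ) : ℝ := 2 * √Real.pi * L

theorem hermiteScale_sq (L : ℝ) : hermiteScale L ^ 2 = 4 * Real.pi * L ^ 2 := by
  rw [hermiteScale, mul_pow, mul_pow, Real.sq_sqrt Real.pi_pos.le]
  ring

theorem hermiteScale_pos {L : ℝ} (hL : 0 < L) : 0 < hermiteScale L := by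
  unfold hermiteScale
  positivity

theorem dilatedHermite_eq (L : ℝ) (k : ℕ) (t : ℝ) : dilatedHermite L k t =
    (((2 : ℝ) ^ (1 / 4 : ℝ) * √L / √(k.factorial : ℝ) : ℝ) : ℂ) *
      (hermiteC k).eval ((hermiteScale L * t : ℝ) : ℂ) *
      (Real.exp (-(Real.pi * (L * t) ^ 2)) : ℝ) := by
  rw [dilatedHermite, ofReal_mul, ofReal_mul]
  congr 2
  rw [hermiteC, Polynomial.eval_map, hermiteScale, ← mul_assoc, Polynomial.aeval_def,
    ← Complex.ofRealHom_eq_coe, Polynomial.hom_eval₂, ofRealHom_eq_coe]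
  rfl

theorem two_rpow_quarter_sq : ((2 : ℝ) ^ (1 / 4 : ℝ)) ^ 2 = √2 := by
  rw [← Real.rpow_natCast, ← Real.rpow_mul (by norm_num), Real.sqrt_eq_rpow]
  norm_num

theorem normalization_eq {L : ℝ} (hL : 0 < L) :
    √2 * L * ((hermiteScale L)⁻¹ * √(2 * Real.pi)) = 1 := by
  rw [hermiteScale, Real.sqrt_mul (by norm_num)]
  have h2 := Real.sq_sqrt (show (0 : ℝ) ≤ 2 by norm_num)
  have hp : √Real.pi ≠ 0 := by positivity
  field_simp
  linarith

theorem integral_polyGauss_scale {L : ℝ} (hL : 0 < L) (P : Polynomial ℂ) (a : ℂ) :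
    ∫ t : ℝ, polyGauss P a (hermiteScale L * t) =
      ((hermiteScale L)⁻¹ : ℝ) * ∫ y, polyGauss P a y := by
  rw [Measure.integral_comp_mul_left (polyGauss P a), abs_of_pos
    (inv_pos.mpr (hermiteScale_pos hL)), real_smul]

theorem coeFn_hermiteL2 (L : ℝ) (hL : 0 < L) (k : ℕ) :
    hermiteL2 L hL k =ᵐ[volume] dilatedHermite L k := MemLp.coeFn_toLp _

theorem gaussianL2_eq_hermiteL2 (L : ℝ) (hL : 0 < L) : gaussianL2 L hL = hermiteL2 L hL 0 := by
  unfold gaussianL2 hermiteL2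
  congr 1
  exact (dilatedHermite_zero L).symm

theorem coeFn_gaussianL2 (L : ℝ) (hL : 0 < L) :
    gaussianL2 L hL =ᵐ[volume] dilatedGaussian L := MemLp.coeFn_toLp _

theorem conj_dilatedHermite (L : ℝ) (k : ℕ) (t : ℝ) :
    (starRingEnd ℂ) (dilatedHermite L k t) = dilatedHermite L k t := conj_ofReal _

theorem inner_hermiteL2 (L : ℝ) (hL : 0 < L) (j k : ℕ) :
    inner ℂ (hermiteL2 L hL j) (hermiteL2 L hL k) = if j = k then 1 else 0 := by
  have e : inner ℂ (hermiteL2 L hL j) (hermiteL2 L hL k) =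
      ∫ t : ℝ, ((√2 * L / (√(j.factorial : ℝ) * √(k.factorial : ℝ)) : ℝ) : ℂ) *
        polyGauss (hermiteC j * hermiteC k) 0 (hermiteScale L * t) := by
    rw [L2.inner_def]
    apply integral_congr_ae
    filter_upwards [coeFn_hermiteL2 L hL j, coeFn_hermiteL2 L hL k] with t h1 h2
    rw [h1, h2, RCLike.inner_apply, conj_dilatedHermite, dilatedHermite_eq, dilatedHermite_eq,
      polyGauss, Polynomial.eval_mul]
    have hexp : cexp (0 * ((hermiteScale L * t : ℝ) : ℂ) - ((hermiteScale L * t : ℝ) : ℂ) ^ 2 / 2) =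
        (Real.exp (-(Real.pi * (L * t) ^ 2)) : ℂ) * (Real.exp (-(Real.pi * (L * t) ^ 2)) : ℂ) := by
      rw [← ofReal_mul, ← Real.exp_add, ← ofReal_pow, mul_pow, hermiteScale_sq, ofReal_exp]
      congr 1
      push_cast
      ring
    have hc : (((2 : ℝ) ^ (1 / 4 : ℝ) * √L / √(j.factorial : ℝ) : ℝ) : ℂ) *
        (((2 : ℝ) ^ (1 / 4 : ℝ) * √L / √(k.factorial : ℝ) : ℝ) : ℂ) =
        ((√2 * L / (√(j.factorial : ℝ) * √(k.factorial : ℝ)) : ℝ) : ℂ) := by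
      rw [← ofReal_mul, ← two_rpow_quarter_sq]
      nth_rewrite 3 [← Real.sq_sqrt hL.le]
      congr 1
      ring
    rw [hexp, ← hc]
    ring
  rw [e, integral_const_mul, integral_polyGauss_scale hL, integral_polyGauss_hermiteC_mul_hermiteC]
  split_ifs with h
  · subst h
    have hn := normalization_eq hL
    have hf : √(j.factorial : ℝ) * √(j.factorial : ℝ) = (j.factorial : ℝ) :=
      Real.mul_self_sqrt (by positivity)
    have hf0 : (j.factorial : ℝ) ≠ 0 := by positivity
    rw [hf]
    have : √2 * L / (j.factorial : ℝ) * ((hermiteScale L)⁻¹ * ((j.factorial : ℝ) * √(2 * Real.pi)))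
        = 1 := by
      rw [← hn]
      field_simp
    exact_mod_cast this
  · simp

theorem orthonormal_hermiteL2 (L : ℝ) (hL : 0 < L) : Orthonormal ℂ (hermiteL2 L hL) := by
  rw [orthonormal_iff_ite]
  exact inner_hermiteL2 L hL

theorem norm_gaussianL2 (L : ℝ) (hL : 0 < L) : ‖gaussianL2 L hL‖ = 1 := by
  rw [gaussianL2_eq_hermiteL2]
  exact (orthonormal_hermiteL2 L hL).1 0

/-- The complex coordinate `L x + i ω / L` adapted to the ellipses of eccentricity `L`. -/
def ellipseCoord (L : ℝ) (z : ℝ × ℝ) : ℂ := ⟨L * z.1, z.2 / L⟩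

/-- The short-time Fourier transform of a Hermite function with Gaussian window. -/
theorem stft_gaussianL2_hermiteL2 (L : ℝ) (hL : 0 < L) (k : ℕ) (z : ℝ × ℝ) :
    stft (gaussianL2 L hL) (hermiteL2 L hL k) z =
      cexp (-(Real.pi * z.1 * z.2 * I)) * ((Real.exp (-(Real.pi * normSq (ellipseCoord L z) / 2)) *
        (√Real.pi ^ k / √(k.factorial : ℝ)) : ℝ) : ℂ) *
        (starRingEnd ℂ) (ellipseCoord L z) ^ k := by
  obtain ⟨x, ω⟩ := z
  -- With `y = hermiteScale L * t`, the modulation and the cross term of the shifted Gaussian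
  -- combine into the single linear exponent `a * y`.
  set a : ℂ := √Real.pi * (starRingEnd ℂ) (ellipseCoord L (x, ω)) with ha
  have ha' : a = √Real.pi * (L * x - ω / L * I) := by
    rw [ha]
    congr 1
    apply Complex.ext <;> simp [ellipseCoord, ← ofReal_mul, ← ofReal_div]
  have hL0 : (L : ℂ) ≠ 0 := ofReal_ne_zero.mpr hL.ne'
  have hpi : ((√Real.pi : ℝ) : ℂ) ^ 2 = Real.pi := by
    rw [← ofReal_pow, Real.sq_sqrt Real.pi_pos.le]
  have e : stft (gaussianL2 L hL) (hermiteL2 L hL k) (x, ω) =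
      ∫ t : ℝ, (((√2 * L / √(k.factorial : ℝ) : ℝ) : ℂ) * cexp (-(Real.pi * L ^ 2 * x ^ 2))) *
        polyGauss (hermiteC k) a (hermiteScale L * t) := by
    rw [stft_eq_integral]
    apply integral_congr_ae
    have hg := (measurePreserving_sub_right volume x).quasiMeasurePreserving.ae_eq_comp
      (coeFn_gaussianL2 L hL)
    filter_upwards [hg, coeFn_hermiteL2 L hL k] with t h1 h2
    simp only [Function.comp_apply] at h1
    rw [h1, h2, ← dilatedHermite_zero, conj_dilatedHermite, dilatedHermite_eq, dilatedHermite_eq,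
      polyGauss, hermiteC_zero]
    have hexp : cexp (-(Real.pi * L ^ 2 * x ^ 2)) *
        cexp (a * ((hermiteScale L * t : ℝ) : ℂ) - ((hermiteScale L * t : ℝ) : ℂ) ^ 2 / 2) =
        cexp (-(2 * Real.pi * I * ω * t)) * ((Real.exp (-(Real.pi * (L * (t - x)) ^ 2)) : ℂ) *
        (Real.exp (-(Real.pi * (L * t) ^ 2)) : ℂ)) := by
      rw [ofReal_exp, ofReal_exp, ← Complex.exp_add, ← Complex.exp_add, ← Complex.exp_add,
        ← ofReal_pow (hermiteScale L * t), mul_pow, hermiteScale_sq, ha', hermiteScale]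
      congr 1
      push_cast
      have : ((√Real.pi : ℝ) : ℂ) * (L * x - ω / L * I) * (2 * (√Real.pi : ℝ) * L * t) =
          ((√Real.pi : ℝ) : ℂ) ^ 2 * 2 * t * (L ^ 2 * x - ω * I) := by
        field_simp
      rw [this, hpi]
      ring
    have hc : (((2 : ℝ) ^ (1 / 4 : ℝ) * √L / √((Nat.factorial 0 : ℕ) : ℝ) : ℝ) : ℂ) *
        (((2 : ℝ) ^ (1 / 4 : ℝ) * √L / √(k.factorial : ℝ) : ℝ) : ℂ) =
        ((√2 * L / √(k.factorial : ℝ) : ℝ) : ℂ) := by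
      rw [← ofReal_mul, ← two_rpow_quarter_sq]
      nth_rewrite 3 [← Real.sq_sqrt hL.le]
      congr 1
      simp
      ring
    have hexp' : ∀ A B : ℂ, A * cexp (-(Real.pi * L ^ 2 * x ^ 2)) * (B *
        cexp (a * ((hermiteScale L * t : ℝ) : ℂ) - ((hermiteScale L * t : ℝ) : ℂ) ^ 2 / 2)) =
        A * B * (cexp (-(2 * Real.pi * I * ω * t)) *
        ((Real.exp (-(Real.pi * (L * (t - x)) ^ 2)) : ℂ) *
        (Real.exp (-(Real.pi * (L * t) ^ 2)) : ℂ))) := fun A B => by rw [← hexp]; ring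
    rw [hexp', ← hc, Polynomial.eval_one]
    ring
  rw [e, integral_const_mul, integral_polyGauss_scale hL, integral_polyGauss_hermiteC]
  have hn : ((√2 : ℝ) : ℂ) * L * (((hermiteScale L)⁻¹ : ℝ) * (√(2 * Real.pi) : ℝ)) = 1 := by
    exact_mod_cast normalization_eq hL
  have hexp2 : cexp (-(Real.pi * L ^ 2 * x ^ 2)) * cexp (a ^ 2 / 2) =
      cexp (-(Real.pi * x * ω * I)) *
        (Real.exp (-(Real.pi * normSq (ellipseCoord L (x, ω)) / 2)) : ℝ) := by
    rw [ofReal_exp, ← Complex.exp_add, ← Complex.exp_add, ha', mul_pow, hpi]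
    congr 1
    simp only [normSq_apply, ellipseCoord]
    push_cast
    field_simp
    ring_nf
    simp only [I_sq]
    ring
  have hak : a ^ k = ((√Real.pi : ℝ) : ℂ) ^ k * (starRingEnd ℂ) (ellipseCoord L (x, ω)) ^ k := by
    rw [ha, mul_pow]
  rw [hak]
  push_cast at hexp2 hn ⊢
  linear_combination (((√Real.pi : ℝ) : ℂ) ^ k * (starRingEnd ℂ) (ellipseCoord L (x, ω)) ^ k /
    ((√(k.factorial : ℝ) : ℝ) : ℂ)) * hexp2 + (cexp (-(Real.pi * L ^ 2 * x ^ 2)) *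
    cexp (a ^ 2 / 2) * ((√Real.pi : ℝ) : ℂ) ^ k * (starRingEnd ℂ) (ellipseCoord L (x, ω)) ^ k /
    ((√(k.factorial : ℝ) : ℝ) : ℂ)) * hn

/-! ### Distance between dilated Gaussians -/

theorem inner_gaussianL2 (L₀ L₁ : ℝ) (h₀ : 0 < L₀) (h₁ : 0 < L₁) :
    inner ℂ (gaussianL2 L₀ h₀) (gaussianL2 L₁ h₁) =
      ((√(2 * L₀ * L₁) / √(L₀ ^ 2 + L₁ ^ 2) : ℝ) : ℂ) := by
  have e : inner ℂ (gaussianL2 L₀ h₀) (gaussianL2 L₁ h₁) =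
      ∫ t : ℝ, ((√(2 * L₀ * L₁) * Real.exp (-(Real.pi * (L₀ ^ 2 + L₁ ^ 2)) * t ^ 2) : ℝ) : ℂ) := by
    rw [L2.inner_def]
    apply integral_congr_ae
    filter_upwards [coeFn_gaussianL2 L₀ h₀, coeFn_gaussianL2 L₁ h₁] with t h1 h2
    rw [h1, h2, RCLike.inner_apply]
    simp only [dilatedGaussian, conj_ofReal]
    rw [← ofReal_mul]
    congr 1
    rw [Real.sqrt_mul (by positivity), Real.sqrt_mul (by positivity), ← two_rpow_quarter_sq]
    have : Real.exp (-(Real.pi * (L₀ ^ 2 + L₁ ^ 2)) * t ^ 2) =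
        Real.exp (-(Real.pi * (L₀ * t) ^ 2)) * Real.exp (-(Real.pi * (L₁ * t) ^ 2)) := by
      rw [← Real.exp_add]
      congr 1
      ring
    rw [this]
    ring
  rw [e, integral_complex_ofReal, integral_const_mul, integral_gaussian]
  congr 1
  rw [← div_div, div_self Real.pi_ne_zero, Real.sqrt_div zero_le_one, Real.sqrt_one]
  ring

theorem norm_gaussianL2_sub_sq (L₀ L₁ : ℝ) (h₀ : 0 < L₀) (h₁ : 0 < L₁) :
    ‖gaussianL2 L₀ h₀ - gaussianL2 L₁ h₁‖ ^ 2 =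
      2 - 2 * (√(2 * L₀ * L₁) / √(L₀ ^ 2 + L₁ ^ 2)) := by
  rw [@norm_sub_sq ℂ, inner_gaussianL2, norm_gaussianL2, norm_gaussianL2, RCLike.re_eq_complex_re,
    ofReal_re]
  ring

theorem norm_gaussianL2_sub_lt_iff (L₀ L₁ : ℝ) (h₀ : 0 < L₀) (h₁ : 0 < L₁) :
    ‖gaussianL2 L₀ h₀ - gaussianL2 L₁ h₁‖ < 1 / 2 ↔
      (64 - √1695) / 49 < L₁ / L₀ ∧ L₁ / L₀ < (64 + √1695) / 49 := by
  have hs : √1695 ^ 2 = 1695 := Real.sq_sqrt (by norm_num)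
  have hs0 : 0 ≤ √1695 := Real.sqrt_nonneg _
  have e1 : ‖gaussianL2 L₀ h₀ - gaussianL2 L₁ h₁‖ < 1 / 2 ↔
      7 / 8 < √(2 * L₀ * L₁ / (L₀ ^ 2 + L₁ ^ 2)) := by
    rw [← sq_lt_sq₀ (norm_nonneg _) (by norm_num), norm_gaussianL2_sub_sq, Real.sqrt_div (by positivity)]
    constructor <;> intro h <;> linarith
  rw [e1, Real.lt_sqrt (by norm_num), lt_div_iff₀ (by positivity)]
  set r := L₁ / L₀ with hr
  have hL : L₁ = r * L₀ := by rw [hr]; field_simp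
  -- The condition is `49 r² - 128 r + 49 < 0`; completing the square produces `64² - 49² = 1695`.
  have e2 : (7 / 8) ^ 2 * (L₀ ^ 2 + L₁ ^ 2) < 2 * L₀ * L₁ ↔ (49 * r - 64) ^ 2 < √1695 ^ 2 := by
    rw [hs, hL]
    have hpos : 0 < L₀ ^ 2 := by positivity
    have : 2 * L₀ * (r * L₀) - (7 / 8) ^ 2 * (L₀ ^ 2 + (r * L₀) ^ 2) =
      L₀ ^ 2 * ((1695 - (49 * r - 64) ^ 2) / 3136) := by ring
    rw [← sub_pos, this, mul_pos_iff_of_pos_left hpos]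
    constructor <;> intro h <;> linarith
  rw [e2, sq_lt_sq, abs_of_nonneg hs0, abs_lt]
  constructor
  · rintro ⟨h1, h2⟩
    constructor <;> linarith
  · rintro ⟨h1, h2⟩
    constructor <;> linarith

/-! ### Completeness of the Hermite functions -/

/-- In a Hilbert space, a vector with equality in Bessel's inequality lies in the closed span. -/
theorem mem_closure_span_of_hasSum_norm_inner_sq {E : Type*} [NormedAddCommGroup E]
    [InnerProductSpace ℂ E] {e : ℕ → E} (he : Orthonormal ℂ e) {v : E}
    (hv : HasSum (fun k => ‖inner ℂ (e k) v‖ ^ 2) (‖v‖ ^ 2)) :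
    v ∈ (Submodule.span ℂ (Set.range e)).topologicalClosure := by
  -- Pythagoras: the squared distance to the partial sum is the Bessel deficit, which `hv` sends to
  -- zero.
  have hn : ∀ n : ℕ, ‖v - ∑ k ∈ Finset.range n, inner ℂ (e k) v • e k‖ ^ 2 =
      ‖v‖ ^ 2 - ∑ k ∈ Finset.range n, ‖inner ℂ (e k) v‖ ^ 2 := by
    intro n
    have h1 : inner ℂ (∑ k ∈ Finset.range n, inner ℂ (e k) v • e k) v =
        ((∑ k ∈ Finset.range n, ‖inner ℂ (e k) v‖ ^ 2 : ℝ) : ℂ) := by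
      rw [sum_inner, ofReal_sum]
      refine Finset.sum_congr rfl fun k _ => ?_
      rw [inner_smul_left, RCLike.conj_mul]
      simp
    have h2 : inner ℂ (∑ k ∈ Finset.range n, inner ℂ (e k) v • e k)
        (∑ k ∈ Finset.range n, inner ℂ (e k) v • e k) =
        ((∑ k ∈ Finset.range n, ‖inner ℂ (e k) v‖ ^ 2 : ℝ) : ℂ) := by
      rw [he.inner_sum, ofReal_sum]
      refine Finset.sum_congr rfl fun k _ => ?_
      rw [RCLike.conj_mul]
      simp
    rw [@norm_sub_sq ℂ, ← inner_conj_symm, h1, ← @inner_self_eq_norm_sq ℂ, ← @inner_self_eq_norm_sq ℂ,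
      h2]
    simp only [RCLike.re_eq_complex_re, conj_ofReal, ofReal_re]
    ring
  have ht : Filter.Tendsto (fun n : ℕ => ∑ k ∈ Finset.range n, inner ℂ (e k) v • e k)
      Filter.atTop (nhds v) := by
    rw [tendsto_iff_norm_sub_tendsto_zero]
    have h3 : Filter.Tendsto (fun n : ℕ =>
        √(‖v‖ ^ 2 - ∑ k ∈ Finset.range n, ‖inner ℂ (e k) v‖ ^ 2)) Filter.atTop (nhds (√0)) := by
      apply (Real.continuous_sqrt.tendsto 0).comp
      have := (tendsto_const_nhds (x := ‖v‖ ^ 2)).sub hv.tendsto_sum_nat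
      rwa [sub_self] at this
    rw [Real.sqrt_zero] at h3
    refine h3.congr fun n => ?_
    rw [← hn, Real.sqrt_sq (norm_nonneg _), norm_sub_rev]
  rw [← SetLike.mem_coe, Submodule.topologicalClosure_coe]
  refine mem_closure_of_tendsto ht (Filter.Eventually.of_forall fun n => ?_)
  exact Submodule.sum_mem _ fun k _ =>
    Submodule.smul_mem _ _ (Submodule.subset_span (Set.mem_range_self k))

theorem norm_stft_gaussianL2_hermiteL2_sq (L : ℝ) (hL : 0 < L) (k : ℕ) (z : ℝ × ℝ) :
    ‖stft (gaussianL2 L hL) (hermiteL2 L hL k) z‖ ^ 2 =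
      Real.exp (-(Real.pi * normSq (ellipseCoord L z))) *
        ((Real.pi * normSq (ellipseCoord L z)) ^ k / (k.factorial : ℝ)) := by
  have h1 : ‖cexp (-(Real.pi * z.1 * z.2 * I))‖ = 1 := by
    have : (-(Real.pi * z.1 * z.2 * I) : ℂ) = ((-(Real.pi * z.1 * z.2) : ℝ) : ℂ) * I := by
      push_cast; ring
    rw [this, norm_exp_ofReal_mul_I]
  rw [stft_gaussianL2_hermiteL2, norm_mul, norm_mul, h1, one_mul, norm_pow, RCLike.norm_conj,
    Complex.norm_real, Real.norm_eq_abs, abs_of_nonneg (by positivity), mul_pow, mul_pow,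
    ← pow_mul, mul_comm k 2, pow_mul, Complex.sq_norm, div_pow, Real.sq_sqrt (by positivity),
    ← pow_mul, mul_comm k 2, pow_mul, Real.sq_sqrt Real.pi_pos.le, ← Real.exp_nat_mul, mul_pow]
  have : ((2 : ℕ) : ℝ) * -(Real.pi * normSq (ellipseCoord L z) / 2) =
      -(Real.pi * normSq (ellipseCoord L z)) := by push_cast; ring
  rw [this]
  ring

theorem hasSum_exp_neg_mul_pow_div_factorial (p : ℝ) :
    HasSum (fun k : ℕ => Real.exp (-p) * (p ^ k / (k.factorial : ℝ))) 1 := by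
  have h := (NormedSpace.expSeries_div_hasSum_exp p).mul_left (Real.exp (-p))
  rwa [← Real.exp_eq_exp_ℝ, ← Real.exp_add, neg_add_cancel, Real.exp_zero] at h

/-- The squared coefficients are Poisson weights with mean `π |w|²`, `w` the ellipse coordinate of
`z`; their sum `1` is the squared norm of the shifted Gaussian. -/
theorem tfShift_gaussianL2_mem_closure_span (L : ℝ) (hL : 0 < L) (z : ℝ × ℝ) :
    tfShift z (gaussianL2 L hL) ∈
      (Submodule.span ℂ (Set.range (hermiteL2 L hL))).topologicalClosure := by
  apply mem_closure_span_of_hasSum_norm_inner_sq (orthonormal_hermiteL2 L hL)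
  rw [norm_tfShift, norm_gaussianL2, one_pow]
  convert hasSum_exp_neg_mul_pow_div_factorial (Real.pi * normSq (ellipseCoord L z)) using 1
  funext k
  rw [norm_inner_symm, ← norm_stft_gaussianL2_hermiteL2_sq, stft]

/-- Moyal's identity makes the transform injective for any nonzero window, so the shifts of the
window are total. -/
theorem eq_zero_of_stft_eq_zero {φ f : L2R} (hφ : φ ≠ 0) (h : ∀ z, stft φ f z = 0) : f = 0 := by
  have := lintegral_enorm_stft_sq φ f
  simp only [h, enorm_zero, ne_eq, OfNat.ofNat_ne_zero, not_false_eq_true, zero_pow,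
    lintegral_zero] at this
  simpa [hφ] using this.symm

/-- The dilated Hermite functions are complete in `L²(ℝ)`. -/
theorem closure_span_hermiteL2 (L : ℝ) (hL : 0 < L) :
    (Submodule.span ℂ (Set.range (hermiteL2 L hL))).topologicalClosure = ⊤ := by
  rw [Submodule.topologicalClosure_eq_top_iff, Submodule.eq_bot_iff]
  intro f hf
  have hφ : gaussianL2 L hL ≠ 0 := by
    rw [← norm_ne_zero_iff, norm_gaussianL2]
    exact one_ne_zero
  refine eq_zero_of_stft_eq_zero hφ fun z => ?_
  rw [← Submodule.orthogonal_closure] at hf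
  exact hf _ (tfShift_gaussianL2_mem_closure_span L hL z)

theorem eq_zero_of_inner_hermiteL2 (L : ℝ) (hL : 0 < L) {f : L2R}
    (h : ∀ k, inner ℂ (hermiteL2 L hL k) f = 0) : f = 0 := by
  have hK := (Submodule.topologicalClosure_eq_top_iff).mp (closure_span_hermiteL2 L hL)
  have : f ∈ (Submodule.span ℂ (Set.range (hermiteL2 L hL)))ᗮ := by
    rw [Submodule.mem_orthogonal]
    intro u hu
    induction hu using Submodule.span_induction with
    | mem x hx => obtain ⟨k, rfl⟩ := hx; exact h k
    | zero => simp
    | add x y _ _ hx hy => rw [inner_add_left, hx, hy, add_zero]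
    | smul a x _ hx => rw [inner_smul_left, hx, mul_zero]
  rwa [hK, Submodule.mem_bot] at this

theorem orthonormal_tfShift_hermiteL2 (L : ℝ) (hL : 0 < L) (γ : ℝ × ℝ) :
    Orthonormal ℂ fun k => tfShift γ (hermiteL2 L hL k) :=
  (orthonormal_hermiteL2 L hL).comp_linearIsometry (tfShiftIsometry γ)

theorem eq_zero_of_inner_tfShift_hermiteL2 (L : ℝ) (hL : 0 < L) (γ : ℝ × ℝ) {f : L2R}
    (h : ∀ k, inner ℂ (tfShift γ (hermiteL2 L hL k)) f = 0) : f = 0 := by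
  obtain ⟨g, rfl⟩ := tfShift_surjective γ f
  simp only [inner_tfShift] at h
  rw [eq_zero_of_inner_hermiteL2 L hL h]
  exact (tfShiftIsometry γ).map_zero

/-- The Hilbert basis of time-frequency shifted dilated Hermite functions. -/
def hermiteBasis (L : ℝ) (hL : 0 < L) (γ : ℝ × ℝ) : HilbertBasis ℕ ℂ L2R :=
  HilbertBasis.mkOfOrthogonalEqBot (orthonormal_tfShift_hermiteL2 L hL γ) <| by
    rw [Submodule.eq_bot_iff]
    intro f hf
    exact eq_zero_of_inner_tfShift_hermiteL2 L hL γ fun k =>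
      hf _ (Submodule.subset_span (Set.mem_range_self k))

theorem hermiteBasis_apply (L : ℝ) (hL : 0 < L) (γ : ℝ × ℝ) (k : ℕ) :
    hermiteBasis L hL γ k = tfShift γ (hermiteL2 L hL k) := by
  rw [hermiteBasis, HilbertBasis.coe_mkOfOrthogonalEqBot]

/-! ### The eigenvalues as Poisson tails -/

/-- The subtracted sum is the head of a Poisson distribution of total mass one. The tail form shows
the sign and allows different radii to be compared term by term. -/
theorem hasSum_ellipseEigenvalue (R : ℝ) (k : ℕ) :
    HasSum (fun j : ℕ => Real.exp (-(Real.pi * R ^ 2)) *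
      ((Real.pi * R ^ 2) ^ (j + (k + 1)) / ((j + (k + 1)).factorial : ℝ)))
      (ellipseEigenvalue R k) := by
  rw [ellipseEigenvalue, Finset.mul_sum]
  exact (hasSum_nat_add_iff' (k + 1)).mpr (hasSum_exp_neg_mul_pow_div_factorial (Real.pi * R ^ 2))

theorem ellipseEigenvalue_succ (R : ℝ) (k : ℕ) : ellipseEigenvalue R (k + 1) =
    ellipseEigenvalue R k - Real.exp (-(Real.pi * R ^ 2)) *
      ((Real.pi * R ^ 2) ^ (k + 1) / ((k + 1).factorial : ℝ)) := by
  rw [ellipseEigenvalue, Finset.sum_range_succ, ellipseEigenvalue]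
  ring

theorem strictAnti_ellipseEigenvalue {R : ℝ} (hR : 0 < R) : StrictAnti (ellipseEigenvalue R) := by
  refine strictAnti_nat_of_succ_lt fun k => ?_
  rw [ellipseEigenvalue_succ]
  exact sub_lt_self _ (by positivity)

theorem ellipseEigenvalue_nonneg (R : ℝ) (k : ℕ) : 0 ≤ ellipseEigenvalue R k :=
  (hasSum_ellipseEigenvalue R k).nonneg fun _ => by positivity

theorem ellipseEigenvalue_pos {R : ℝ} (hR : 0 < R) (k : ℕ) : 0 < ellipseEigenvalue R k :=
  (ellipseEigenvalue_nonneg R (k + 1)).trans_lt (strictAnti_ellipseEigenvalue hR k.lt_succ_self)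

theorem ellipseEigenvalue_le_one (R : ℝ) (k : ℕ) : ellipseEigenvalue R k ≤ 1 :=
  sub_le_self _ (by positivity)

theorem tendsto_ellipseEigenvalue (R : ℝ) :
    Filter.Tendsto (ellipseEigenvalue R) Filter.atTop (nhds 0) := by
  have h := (hasSum_exp_neg_mul_pow_div_factorial (Real.pi * R ^ 2)).tendsto_sum_nat
  have h2 := ((Filter.tendsto_add_atTop_iff_nat 1).mpr h).const_sub 1
  rw [sub_self] at h2
  refine h2.congr fun k => ?_
  rw [ellipseEigenvalue, Finset.mul_sum]

/-- Doubling the radius multiplies `π R²` by `4`, so every tail term, having order at least `k + 1`,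
gains at least `4 ^ (k + 1)`; the exponential prefactor loses only `exp (3 π R²)`. This drives the
truncation to finitely many windows. -/
theorem ellipseEigenvalue_le_mul_ellipseEigenvalue_two_mul (R : ℝ) (k : ℕ) :
    ellipseEigenvalue R k ≤
      Real.exp (3 * (Real.pi * R ^ 2)) * (1 / 4) ^ (k + 1) * ellipseEigenvalue (2 * R) k := by
  refine hasSum_le (fun j => ?_) (hasSum_ellipseEigenvalue R k)
    ((hasSum_ellipseEigenvalue (2 * R) k).mul_left _)
  generalize hp : Real.pi * R ^ 2 = p
  have hp0 : 0 ≤ p := by rw [← hp]; positivity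
  have h4 : Real.pi * (2 * R) ^ 2 = 4 * p := by rw [← hp]; ring
  have he : Real.exp (-p) = Real.exp (3 * p) * Real.exp (-(4 * p)) := by
    rw [← Real.exp_add]; congr 1; ring
  rw [h4, he, mul_pow 4 p, pow_add 4]
  have h1 : (1 : ℝ) ≤ 4 ^ j := one_le_pow₀ (by norm_num)
  calc Real.exp (3 * p) * Real.exp (-(4 * p)) * (p ^ (j + (k + 1)) / ((j + (k + 1)).factorial : ℝ))
      ≤ 4 ^ j * (Real.exp (3 * p) * Real.exp (-(4 * p)) *
        (p ^ (j + (k + 1)) / ((j + (k + 1)).factorial : ℝ))) :=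
        le_mul_of_one_le_left (by positivity) h1
    _ = _ := by
      have : ((1 : ℝ) / 4) ^ (k + 1) * 4 ^ (k + 1) = 1 := by
        rw [← mul_pow]; norm_num
      linear_combination -(4 ^ j * (Real.exp (3 * p) * Real.exp (-(4 * p)) *
        (p ^ (j + (k + 1)) / ((j + (k + 1)).factorial : ℝ)))) * this

/-- The derivatives of the Poisson terms telescope to a single one, the radial energy density of the
`k`-th Hermite function's transform. -/
theorem hasDerivAt_ellipseEigenvalue (k : ℕ) (r : ℝ) :
    HasDerivAt (fun r => ellipseEigenvalue r k)
      (2 * Real.pi * r * (Real.exp (-(Real.pi * r ^ 2)) *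
        ((Real.pi * r ^ 2) ^ k / (k.factorial : ℝ)))) r := by
  have hq : HasDerivAt (fun r : ℝ => Real.pi * r ^ 2) (2 * Real.pi * r) r := by
    refine ((hasDerivAt_pow 2 r).const_mul Real.pi).congr_deriv ?_
    simp
    ring
  have he : HasDerivAt (fun r : ℝ => Real.exp (-(Real.pi * r ^ 2)))
      (Real.exp (-(Real.pi * r ^ 2)) * -(2 * Real.pi * r)) r := hq.fun_neg.exp
  induction k with
  | zero =>
    have : (fun r => ellipseEigenvalue r 0) = fun r => 1 - Real.exp (-(Real.pi * r ^ 2)) := by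
      funext r
      simp [ellipseEigenvalue]
    rw [this]
    refine (he.const_sub 1).congr_deriv ?_
    simp
    ring
  | succ k ih =>
    have : (fun r => ellipseEigenvalue r (k + 1)) = fun r => ellipseEigenvalue r k -
        Real.exp (-(Real.pi * r ^ 2)) *
      ((Real.pi * r ^ 2) ^ (k + 1) / ((k + 1).factorial : ℝ)) :=
      funext fun r => ellipseEigenvalue_succ r k
    rw [this]
    refine (ih.sub (he.fun_mul ((hq.fun_pow (k + 1)).div_const _))).congr_deriv ?_
    have hk : ((k + 1).factorial : ℝ) = (k + 1) * (k.factorial : ℝ) := by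
      rw [Nat.factorial_succ]; push_cast; ring
    have hk0 : (k.factorial : ℝ) ≠ 0 := by positivity
    have hk1 : (k + 1 : ℝ) ≠ 0 := by positivity
    rw [hk]
    simp only [Nat.add_sub_cancel, Nat.cast_add, Nat.cast_one]
    field_simp
    ring

theorem ellipseEigenvalue_zero_left (k : ℕ) : ellipseEigenvalue 0 k = 0 := by
  rw [ellipseEigenvalue, Finset.sum_range_succ']
  simp

theorem integral_radial_eq_ellipseEigenvalue {R : ℝ} (k : ℕ) :
    ∫ r in (0 : ℝ)..R, 2 * Real.pi * r * (Real.exp (-(Real.pi * r ^ 2)) *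
        ((Real.pi * r ^ 2) ^ k / (k.factorial : ℝ))) = ellipseEigenvalue R k := by
  rw [intervalIntegral.integral_eq_sub_of_hasDerivAt
    (fun r _ => hasDerivAt_ellipseEigenvalue k r)
    (Continuous.intervalIntegrable (by fun_prop) _ _), ellipseEigenvalue_zero_left, sub_zero]

/-! ### Orthogonality over discs and ellipses -/

theorem integral_exp_int_mul (j k : ℕ) :
    ∫ θ in Set.Ioo (-Real.pi) Real.pi, cexp ((((j : ℤ) - k : ℤ) : ℂ) * I * (θ : ℝ)) =
      if j = k then (2 * Real.pi : ℂ) else 0 := by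
  rw [← integral_Ioc_eq_integral_Ioo, ← intervalIntegral.integral_of_le (by linarith [Real.pi_pos])]
  split_ifs with h
  · subst h
    simp
    ring
  · have hn : ((j : ℤ) - k : ℤ) ≠ 0 := by omega
    have hc : (((j : ℤ) - k : ℤ) : ℂ) * I ≠ 0 := mul_ne_zero (Int.cast_ne_zero.mpr hn) I_ne_zero
    rw [integral_exp_mul_complex hc, div_eq_zero_iff]
    left
    rw [sub_eq_zero, Complex.exp_eq_exp_iff_exists_int]
    refine ⟨(j : ℤ) - k, ?_⟩
    push_cast
    ring

theorem mem_ellipse_iff {L R : ℝ} {z : ℝ × ℝ} :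
    z ∈ ellipse L R ↔ normSq (ellipseCoord L z) ≤ R ^ 2 := by
  simp only [ellipse, Set.mem_ofPred_eq, normSq_apply, ellipseCoord]
  ring_nf

theorem isClosed_ellipse (L R : ℝ) : IsClosed (ellipse L R) := by
  refine isClosed_le ?_ continuous_const
  fun_prop

theorem isCompact_ellipse {L : ℝ} (hL : 0 < L) (R : ℝ) : IsCompact (ellipse L R) := by
  refine (isCompact_Icc (a := (-(|R| / L), -(|R| * L))) (b := (|R| / L, |R| * L))).of_isClosed_subset
    (isClosed_ellipse L R) fun z hz => ?_
  simp only [ellipse, Set.mem_ofPred_eq] at hz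
  have h1 : (L * z.1) ^ 2 ≤ R ^ 2 := by
    have : 0 ≤ z.2 ^ 2 / L ^ 2 := by positivity
    nlinarith
  have h2 : (z.2 / L) ^ 2 ≤ R ^ 2 := by
    have : 0 ≤ L ^ 2 * z.1 ^ 2 := by positivity
    rw [div_pow]
    linarith
  have h1' := abs_le.mp (sq_le_sq.mp h1)
  have h2' := abs_le.mp (sq_le_sq.mp h2)
  rw [Set.mem_Icc, Prod.le_def, Prod.le_def]
  refine ⟨⟨?_, ?_⟩, ?_, ?_⟩
  · simp only [neg_le]
    rw [le_div_iff₀ hL]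
    nlinarith
  · have h3 := h2'.1
    rw [le_div_iff₀ hL] at h3
    simpa using h3
  · simp only
    rw [le_div_iff₀ hL]
    nlinarith
  · have h3 := h2'.2
    rwa [div_le_iff₀ hL] at h3

theorem measurePreserving_dilation {L : ℝ} (hL : 0 < L) :
    MeasurePreserving (fun z : ℝ × ℝ => (L * z.1, z.2 / L)) volume volume := by
  refine ⟨by fun_prop, ?_⟩
  have h1 := Real.map_volume_mul_left hL.ne'
  have h2 := Real.map_volume_mul_right (inv_ne_zero hL.ne')
  have e : (fun z : ℝ × ℝ => (L * z.1, z.2 / L)) = Prod.map (L * ·) (· * L⁻¹) := by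
    funext z
    rw [Prod.map, div_eq_mul_inv]
  rw [e, Measure.volume_eq_prod, ← Measure.map_prod_map volume volume (by fun_prop) (by fun_prop),
    h1, h2, inv_inv, Measure.prod_smul_left, Measure.prod_smul_right, smul_smul,
    ← ENNReal.ofReal_mul (abs_nonneg _), ← abs_mul, inv_mul_cancel₀ hL.ne']
  simp

/-- In polar coordinates the integrand factors: the angular integral vanishes unless the exponents
agree, and the radial integral is then the Poisson tail up to normalization. -/
theorem setIntegral_disc_pow_mul_conj_pow {R : ℝ} (hR : 0 < R) (j k : ℕ) :
    ∫ z in {z : ℝ × ℝ | normSq ⟨z.1, z.2⟩ ≤ R ^ 2},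
      (Real.exp (-(Real.pi * normSq ⟨z.1, z.2⟩)) : ℂ) *
        ((⟨z.1, z.2⟩ : ℂ) ^ j * (starRingEnd ℂ) (⟨z.1, z.2⟩ : ℂ) ^ k) =
      if j = k then ((k.factorial / Real.pi ^ k * ellipseEigenvalue R k : ℝ) : ℂ) else 0 := by
  have hmeas : MeasurableSet {z : ℝ × ℝ | normSq ⟨z.1, z.2⟩ ≤ R ^ 2} := by
    simp only [normSq_mk]
    exact (isClosed_le (by fun_prop) continuous_const).measurableSet
  rw [← integral_indicator hmeas, ← integral_comp_polarCoord_symm, polarCoord_target]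
  have e : ∀ p ∈ Set.Ioi (0 : ℝ) ×ˢ Set.Ioo (-Real.pi) Real.pi,
      p.1 • Set.indicator {z : ℝ × ℝ | normSq ⟨z.1, z.2⟩ ≤ R ^ 2} (fun z : ℝ × ℝ =>
        (Real.exp (-(Real.pi * normSq ⟨z.1, z.2⟩)) : ℂ) *
        ((⟨z.1, z.2⟩ : ℂ) ^ j * (starRingEnd ℂ) (⟨z.1, z.2⟩ : ℂ) ^ k)) (polarCoord.symm p) =
      ((Set.Iic R).indicator (fun r : ℝ => r * (Real.exp (-(Real.pi * r ^ 2)) * r ^ (j + k))) p.1 : ℝ) *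
        cexp ((((j : ℤ) - k : ℤ) : ℂ) * I * (p.2 : ℝ)) := by
    rintro ⟨r, θ⟩ ⟨hr, -⟩
    simp only [Set.mem_Ioi] at hr
    have hz : (⟨r * Real.cos θ, r * Real.sin θ⟩ : ℂ) = r * cexp (θ * I) := by
      rw [exp_mul_I]
      apply Complex.ext <;> simp [← ofReal_cos, ← ofReal_sin]
    have hn : normSq (r * cexp (θ * I)) = r ^ 2 := by
      rw [normSq_mul, normSq_ofReal, normSq_eq_norm_sq, norm_exp_ofReal_mul_I]
      ring
    simp only [polarCoord_symm_apply]
    by_cases hrR : r ≤ R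
    · rw [Set.indicator_of_mem, Set.indicator_of_mem (by exact hrR)]
      · simp only [hz, hn]
        have hc : (starRingEnd ℂ) (r * cexp (θ * I)) = r * cexp (-(θ * I)) := by
          rw [map_mul, conj_ofReal, ← Complex.exp_conj, map_mul, conj_ofReal, conj_I, mul_neg]
        have hexp : cexp ((((j : ℤ) - k : ℤ) : ℂ) * I * θ) =
            cexp (θ * I) ^ j * cexp (-(θ * I)) ^ k := by
          rw [← Complex.exp_nat_mul, ← Complex.exp_nat_mul, ← Complex.exp_add]
          congr 1
          push_cast
          ring
        rw [hc, hexp, real_smul]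
        push_cast
        ring
      · simp only [Set.mem_ofPred_eq, hz, hn]
        exact pow_le_pow_left₀ hr.le hrR 2
    · rw [Set.indicator_of_notMem, Set.indicator_of_notMem (by exact hrR)]
      · simp
      · simp only [Set.mem_ofPred_eq, hz, hn]
        exact fun h => hrR (abs_le_of_sq_le_sq' h hR.le).2
  rw [setIntegral_congr_fun (measurableSet_Ioi.prod measurableSet_Ioo) e, Measure.volume_eq_prod,
    setIntegral_prod_mul (fun r : ℝ => (((Set.Iic R).indicator (fun r : ℝ =>
      r * (Real.exp (-(Real.pi * r ^ 2)) * r ^ (j + k))) r : ℝ) : ℂ))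
      (fun θ : ℝ => cexp ((((j : ℤ) - k : ℤ) : ℂ) * I * θ)), integral_exp_int_mul]
  split_ifs with h
  · subst h
    rw [integral_complex_ofReal, setIntegral_indicator measurableSet_Iic, Set.Ioi_inter_Iic,
      ← intervalIntegral.integral_of_le hR.le, ← integral_radial_eq_ellipseEigenvalue,
      ← intervalIntegral.integral_const_mul]
    have h2 : (2 * Real.pi : ℂ) = ((2 * Real.pi : ℝ) : ℂ) := by push_cast; rfl
    rw [h2, ← ofReal_mul, ← intervalIntegral.integral_mul_const]
    congr 2
    funext r
    have : (j.factorial : ℝ) ≠ 0 := by positivity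
    have := Real.pi_ne_zero
    field_simp
    ring
  · rw [mul_zero]

/-- The phase does not depend on the Hermite index and cancels against its conjugate; an
area-preserving dilation turns the ellipse into a disc. -/
theorem setIntegral_ellipse_stft_hermiteL2 (L : ℝ) (hL : 0 < L) {R : ℝ} (hR : 0 < R) (j k : ℕ) :
    ∫ z in ellipse L R, stft (gaussianL2 L hL) (hermiteL2 L hL k) z *
      (starRingEnd ℂ) (stft (gaussianL2 L hL) (hermiteL2 L hL j) z) =
      if j = k then (ellipseEigenvalue R k : ℂ) else 0 := by
  set c : ℝ := √Real.pi ^ k / √(k.factorial : ℝ) * (√Real.pi ^ j / √(j.factorial : ℝ)) with hc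
  set F : ℝ × ℝ → ℂ := fun z => (Real.exp (-(Real.pi * normSq ⟨z.1, z.2⟩)) : ℂ) *
        ((⟨z.1, z.2⟩ : ℂ) ^ j * (starRingEnd ℂ) (⟨z.1, z.2⟩ : ℂ) ^ k) with hF
  have e1 : ∀ z : ℝ × ℝ, stft (gaussianL2 L hL) (hermiteL2 L hL k) z *
      (starRingEnd ℂ) (stft (gaussianL2 L hL) (hermiteL2 L hL j) z) =
      c * F (L * z.1, z.2 / L) := by
    intro z
    have hz : (⟨L * z.1, z.2 / L⟩ : ℂ) = ellipseCoord L z := rfl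
    have hph : cexp (-(Real.pi * z.1 * z.2 * I)) *
        (starRingEnd ℂ) (cexp (-(Real.pi * z.1 * z.2 * I))) = 1 := by
      rw [← Complex.exp_conj, ← Complex.exp_add]
      simp
    have he : Real.exp (-(Real.pi * normSq (ellipseCoord L z))) =
        Real.exp (-(Real.pi * normSq (ellipseCoord L z) / 2)) ^ 2 := by
      rw [← Real.exp_nat_mul]; congr 1; push_cast; ring
    simp only [hF, hz, he, stft_gaussianL2_hermiteL2, map_mul, map_pow, conj_conj, conj_ofReal, hc, ofReal_mul, ofReal_div, ofReal_pow,
      map_div₀]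
    linear_combination ((Real.exp (-(Real.pi * normSq (ellipseCoord L z) / 2)) : ℂ) ^ 2 *
      ((√Real.pi : ℂ) ^ k / (√(k.factorial : ℝ) : ℂ)) *
      ((√Real.pi : ℂ) ^ j / (√(j.factorial : ℝ) : ℂ)) * ellipseCoord L z ^ j *
      (starRingEnd ℂ) (ellipseCoord L z) ^ k) * hph
  have hpre : ellipse L R = (fun z : ℝ × ℝ => (L * z.1, z.2 / L)) ⁻¹'
      {z : ℝ × ℝ | normSq ⟨z.1, z.2⟩ ≤ R ^ 2} := by
    ext z
    exact mem_ellipse_iff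
  have hemb : MeasurableEmbedding (fun z : ℝ × ℝ => (L * z.1, z.2 / L)) := by
    have : Topology.IsClosedEmbedding (fun z : ℝ × ℝ => (L * z.1, z.2 / L)) := by
      exact ((Homeomorph.mulLeft₀ L hL.ne').prodCongr (Homeomorph.mulRight₀ L⁻¹ (inv_ne_zero hL.ne'))).isClosedEmbedding
    exact this.measurableEmbedding
  simp only [e1]
  rw [integral_const_mul, hpre,
    (measurePreserving_dilation hL).setIntegral_preimage_emb hemb F,
    setIntegral_disc_pow_mul_conj_pow hR]
  split_ifs with h
  · subst h
    rw [← ofReal_mul]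
    congr 1
    have h1 : √(j.factorial : ℝ) * √(j.factorial : ℝ) = (j.factorial : ℝ) :=
      Real.mul_self_sqrt (by positivity)
    have h2 : √Real.pi ^ j * √Real.pi ^ j = Real.pi ^ j := by
      rw [← mul_pow, Real.mul_self_sqrt Real.pi_pos.le]
    rw [hc, div_mul_div_comm, h1, h2]
    have h3 : (j.factorial : ℝ) ≠ 0 := by positivity
    have h4 := Real.pi_ne_zero
    field_simp
  · rw [mul_zero]

/-! ### Spectral decomposition of the localization operators -/

/-- The translated ellipse `γ + ellipse L R`. -/
def ellipseAt (L R : ℝ) (γ : ℝ × ℝ) : Set (ℝ × ℝ) := {z | z - γ ∈ ellipse L R}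

theorem isCompact_ellipseAt {L : ℝ} (hL : 0 < L) (R : ℝ) (γ : ℝ × ℝ) :
    IsCompact (ellipseAt L R γ) :=
  (Homeomorph.subRight γ).isCompact_preimage.mpr (isCompact_ellipse hL R)

theorem measurableSet_ellipseAt (L R : ℝ) (γ : ℝ × ℝ) : MeasurableSet (ellipseAt L R γ) :=
  (isClosed_ellipse L R).measurableSet.preimage (measurable_id.sub_const γ)

/-- Expansion in one fixed orthonormal basis exhibits the orbit map as a pointwise limit of finite
sums with measurable coefficients. -/
theorem stronglyMeasurable_tfShift (φ : L2R) : StronglyMeasurable fun z => tfShift z φ := by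
  set b := hermiteBasis 1 one_pos 0
  refine stronglyMeasurable_of_tendsto Filter.atTop
    (f := fun (n : ℕ) z => ∑ k ∈ Finset.range n, (starRingEnd ℂ) (stft φ (b k) z) • b k)
    (fun n => ?_) ?_
  · refine Finset.stronglyMeasurable_fun_sum _ fun k _ => ?_
    exact (Complex.continuous_conj.comp_stronglyMeasurable
      (stronglyMeasurable_stft φ (b k))).smul_const _
  · rw [tendsto_pi_nhds]
    intro z
    refine ((b.hasSum_repr (tfShift z φ)).tendsto_sum_nat).congr fun n => ?_
    refine Finset.sum_congr rfl fun k _ => ?_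
    rw [b.repr_apply_apply, stft, inner_conj_symm]

theorem integrable_localizationOp_integrand {L : ℝ} (hL : 0 < L) (R : ℝ) (γ : ℝ × ℝ) (φ f : L2R) :
    Integrable fun z => (stft φ f z * (ellipseSymbol L R γ z : ℂ)) • tfShift z φ := by
  have hm := measurableSet_ellipseAt L R γ
  have hsm : StronglyMeasurable fun z => stft φ f z • tfShift z φ :=
    (stronglyMeasurable_stft φ f).smul (stronglyMeasurable_tfShift φ)
  have h : IntegrableOn (fun z => stft φ f z • tfShift z φ) (ellipseAt L R γ) := by
    refine Measure.integrableOn_of_bounded (M := ‖φ‖ * ‖f‖ * ‖φ‖)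
      (isCompact_ellipseAt hL R γ).measure_lt_top.ne hsm.aestronglyMeasurable
      (Filter.Eventually.of_forall fun z => ?_)
    rw [norm_smul, norm_tfShift]
    gcongr
    exact norm_stft_le φ f z
  rw [← integrable_indicator_iff hm] at h
  refine h.congr (Filter.Eventually.of_forall fun z => ?_)
  by_cases hz : z ∈ ellipseAt L R γ
  · have : ellipseSymbol L R γ z = 1 := Set.indicator_of_mem hz _
    simp only [Set.indicator_of_mem hz, this, ofReal_one, mul_one]
  · have : ellipseSymbol L R γ z = 0 := Set.indicator_of_notMem hz _
    simp only [Set.indicator_of_notMem hz, this, ofReal_zero, mul_zero, zero_smul]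

/-- The weak form of the localization operator on a translated ellipse. -/
theorem inner_localizationOp {L : ℝ} (hL : 0 < L) (R : ℝ) (γ : ℝ × ℝ) (φ f g : L2R) :
    inner ℂ g (localizationOp (ellipseSymbol L R γ) φ f) =
      ∫ z in ellipseAt L R γ, stft φ f z * (starRingEnd ℂ) (stft φ g z) := by
  rw [localizationOp, ← integral_inner (integrable_localizationOp_integrand hL R γ φ f),
    ← integral_indicator (measurableSet_ellipseAt L R γ)]
  congr 1 with z
  rw [inner_smul_right, ← inner_conj_symm g, ← stft]
  by_cases hz : z ∈ ellipseAt L R γ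
  · have : ellipseSymbol L R γ z = 1 := Set.indicator_of_mem hz _
    simp only [Set.indicator_of_mem hz, this, ofReal_one, mul_one]
  · have : ellipseSymbol L R γ z = 0 := Set.indicator_of_notMem hz _
    simp only [Set.indicator_of_notMem hz, this, ofReal_zero, mul_zero, zero_mul]

/-- Translation moves the ellipse to the origin, and the covariance phases of the two transforms
cancel. -/
theorem inner_localizationOp_tfShift {L : ℝ} (hL : 0 < L) (R : ℝ) (γ : ℝ × ℝ) (φ f g : L2R) :
    inner ℂ (tfShift γ g) (localizationOp (ellipseSymbol L R γ) φ (tfShift γ f)) =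
      ∫ z in ellipse L R, stft φ f z * (starRingEnd ℂ) (stft φ g z) := by
  have hpre : ellipse L R = (fun z => γ + z) ⁻¹' ellipseAt L R γ := by
    ext z
    simp [ellipseAt]
  rw [inner_localizationOp hL, hpre, ← (measurePreserving_add_left volume γ).setIntegral_preimage_emb
    (measurableEmbedding_addLeft γ)]
  congr 1 with z
  rw [stft_tfShift, stft_tfShift, map_mul]
  have h1 : cexp (2 * Real.pi * I * (-z.2 : ℝ) * γ.1) *
      (starRingEnd ℂ) (cexp (2 * Real.pi * I * (-z.2 : ℝ) * γ.1)) = 1 := by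
    rw [RCLike.mul_conj, norm_exp_two_pi_I_mul]
    simp
  linear_combination (stft φ f z * (starRingEnd ℂ) (stft φ g z)) * h1

theorem inner_localizationOp_conj_symm {L : ℝ} (hL : 0 < L) (R : ℝ) (γ : ℝ × ℝ) (φ f g : L2R) :
    inner ℂ g (localizationOp (ellipseSymbol L R γ) φ f) =
      inner ℂ (localizationOp (ellipseSymbol L R γ) φ g) f := by
  rw [← inner_conj_symm (localizationOp (ellipseSymbol L R γ) φ g), inner_localizationOp hL,
    inner_localizationOp hL, ← integral_conj]
  congr 1 with z
  rw [map_mul, conj_conj, mul_comm]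

/-- The time-frequency shifted Hermite functions are eigenfunctions of the localization operator. -/
theorem localizationOp_tfShift_hermiteL2 {L : ℝ} (hL : 0 < L) {R : ℝ} (hR : 0 < R) (γ : ℝ × ℝ)
    (k : ℕ) :
    localizationOp (ellipseSymbol L R γ) (gaussianL2 L hL) (tfShift γ (hermiteL2 L hL k)) =
      (ellipseEigenvalue R k : ℂ) • tfShift γ (hermiteL2 L hL k) := by
  rw [← sub_eq_zero]
  refine eq_zero_of_inner_tfShift_hermiteL2 L hL γ fun j => ?_
  rw [inner_sub_right, inner_smul_right, inner_tfShift, inner_hermiteL2,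
    inner_localizationOp_tfShift hL, setIntegral_ellipse_stft_hermiteL2 L hL hR]
  split_ifs <;> simp

theorem inner_tfShift_hermiteL2_localizationOp {L : ℝ} (hL : 0 < L) {R : ℝ} (hR : 0 < R)
    (γ : ℝ × ℝ) (k : ℕ) (f : L2R) :
    inner ℂ (tfShift γ (hermiteL2 L hL k))
      (localizationOp (ellipseSymbol L R γ) (gaussianL2 L hL) f) =
      (ellipseEigenvalue R k : ℂ) * inner ℂ (tfShift γ (hermiteL2 L hL k)) f := by
  rw [inner_localizationOp_conj_symm hL, localizationOp_tfShift_hermiteL2 hL hR, inner_smul_left,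
    conj_ofReal]

/-- The eigenvalues are strictly decreasing in `k`, hence simple: an eigenvector has exactly one
nonzero coefficient in the shifted Hermite basis. -/
theorem localizationOp_eigen_iff {L : ℝ} (hL : 0 < L) {R : ℝ} (hR : 0 < R) (γ : ℝ × ℝ)
    (f : L2R) (μ : ℂ) :
    (f ≠ 0 ∧ localizationOp (ellipseSymbol L R γ) (gaussianL2 L hL) f = μ • f) ↔
      ∃ k : ℕ, μ = (ellipseEigenvalue R k : ℂ) ∧
        ∃ c : ℂ, c ≠ 0 ∧ f = c • tfShift γ (hermiteL2 L hL k) := by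
  constructor
  · rintro ⟨hf, hμ⟩
    have hk : ∀ k, (ellipseEigenvalue R k : ℂ) * inner ℂ (tfShift γ (hermiteL2 L hL k)) f =
        μ * inner ℂ (tfShift γ (hermiteL2 L hL k)) f := fun k => by
      rw [← inner_tfShift_hermiteL2_localizationOp hL hR, hμ, inner_smul_right]
    obtain ⟨k, hk0⟩ : ∃ k, inner ℂ (tfShift γ (hermiteL2 L hL k)) f ≠ 0 := by
      by_contra! h
      exact hf (eq_zero_of_inner_tfShift_hermiteL2 L hL γ h)
    have hμk : μ = (ellipseEigenvalue R k : ℂ) := (mul_right_cancel₀ hk0 (hk k)).symm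
    refine ⟨k, hμk, _, hk0, ?_⟩
    rw [← sub_eq_zero]
    refine eq_zero_of_inner_tfShift_hermiteL2 L hL γ fun j => ?_
    rw [inner_sub_right, inner_smul_right, inner_tfShift, inner_hermiteL2]
    split_ifs with h
    · rw [h, mul_one, sub_self]
    · rw [mul_zero, sub_zero]
      by_contra hj
      have := mul_right_cancel₀ hj (hk j)
      rw [hμk, ofReal_inj] at this
      exact h ((strictAnti_ellipseEigenvalue hR).injective this)
  · rintro ⟨k, rfl, c, hc, rfl⟩
    have hne : tfShift γ (hermiteL2 L hL k) ≠ 0 := (orthonormal_tfShift_hermiteL2 L hL γ).ne_zero k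
    refine ⟨smul_ne_zero hc hne, ?_⟩
    rw [← sub_eq_zero]
    refine eq_zero_of_inner_tfShift_hermiteL2 L hL γ fun j => ?_
    rw [inner_sub_right, inner_tfShift_hermiteL2_localizationOp hL hR, inner_smul_right,
      inner_smul_right, inner_smul_right, inner_tfShift, inner_hermiteL2]
    split_ifs with h
    · rw [h, sub_self]
    · simp

/-- The energy of the short-time Fourier transform on a translated ellipse in terms of Hermite
coefficients. -/
theorem tsum_ellipseEigenvalue_mul {L : ℝ} (hL : 0 < L) {R : ℝ} (hR : 0 < R) (γ : ℝ × ℝ) (f : L2R) :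
    ∑' k, ENNReal.ofReal (ellipseEigenvalue R k) *
      ‖inner ℂ f (tfShift γ (hermiteL2 L hL k))‖ₑ ^ 2 =
      ∫⁻ z in ellipseAt L R γ, ‖stft (gaussianL2 L hL) f z‖ₑ ^ 2 := by
  set φ := gaussianL2 L hL
  -- Parseval for `⟨f, H f⟩`: the diagonal form of `H` gives the series, its weak form gives the
  -- integral.
  have h1 := (hermiteBasis L hL γ).hasSum_inner_mul_inner f
    (localizationOp (ellipseSymbol L R γ) φ f)
  have h2 : HasSum (fun k => ((ellipseEigenvalue R k *
      ‖inner ℂ f (tfShift γ (hermiteL2 L hL k))‖ ^ 2 : ℝ) : ℂ))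
      ((∫ z in ellipseAt L R γ, ‖stft φ f z‖ ^ 2 : ℝ) : ℂ) := by
    have hfun : (fun k => ((ellipseEigenvalue R k *
        ‖inner ℂ f (tfShift γ (hermiteL2 L hL k))‖ ^ 2 : ℝ) : ℂ)) = fun k =>
        inner ℂ f (hermiteBasis L hL γ k) * inner ℂ (hermiteBasis L hL γ k)
          (localizationOp (ellipseSymbol L R γ) φ f) := by
      funext k
      rw [hermiteBasis_apply, inner_tfShift_hermiteL2_localizationOp hL hR,
        ← inner_conj_symm (tfShift γ (hermiteL2 L hL k)) f, mul_left_comm, RCLike.mul_conj]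
      push_cast
      rfl
    have hval : ((∫ z in ellipseAt L R γ, ‖stft φ f z‖ ^ 2 : ℝ) : ℂ) =
        inner ℂ f (localizationOp (ellipseSymbol L R γ) φ f) := by
      rw [inner_localizationOp hL, ← integral_complex_ofReal]
      congr 1 with z
      rw [RCLike.mul_conj]
      push_cast
      rfl
    rw [hfun, hval]
    exact h1
  have h3 := hasSum_ofReal.mp h2
  have hint : IntegrableOn (fun z => ‖stft φ f z‖ ^ 2) (ellipseAt L R γ) := by
    refine Measure.integrableOn_of_bounded (M := (‖φ‖ * ‖f‖) ^ 2)
      (isCompact_ellipseAt hL R γ).measure_lt_top.ne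
      ((stronglyMeasurable_stft φ f).norm.pow 2).aestronglyMeasurable
      (Filter.Eventually.of_forall fun z => ?_)
    rw [norm_pow, norm_norm]
    gcongr
    exact norm_stft_le φ f z
  have h4 : ∀ w : ℂ, ‖w‖ₑ ^ 2 = ENNReal.ofReal (‖w‖ ^ 2) := fun w => by
    rw [ENNReal.ofReal_pow (norm_nonneg _), ofReal_norm]
  simp only [h4]
  rw [← ofReal_integral_eq_lintegral_ofReal hint (Filter.Eventually.of_forall fun z => by positivity),
    ← h3.tsum_eq, ENNReal.ofReal_tsum_of_nonneg
      (fun k => mul_nonneg (ellipseEigenvalue_nonneg R k) (by positivity)) h3.summable]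
  congr 1 with k
  rw [ENNReal.ofReal_mul (ellipseEigenvalue_nonneg R k)]

/-! ### Overlap counts and Bessel bounds -/

theorem ellipseSymbol_eq_indicator (L R : ℝ) (γ z : ℝ × ℝ) :
    ENNReal.ofReal (ellipseSymbol L R γ z) = (ellipseAt L R γ).indicator 1 z := by
  by_cases hz : z ∈ ellipseAt L R γ
  · have : ellipseSymbol L R γ z = 1 := Set.indicator_of_mem hz _
    rw [this, Set.indicator_of_mem hz]
    simp
  · have : ellipseSymbol L R γ z = 0 := Set.indicator_of_notMem hz _
    rw [this, Set.indicator_of_notMem hz]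
    simp

theorem ellipseSymbol_nonneg (L R : ℝ) (γ z : ℝ × ℝ) : 0 ≤ ellipseSymbol L R γ z :=
  Set.indicator_nonneg (fun _ _ => zero_le_one) _

theorem SumApproxOne.exists_mem_ellipseAt {Γ : Set (ℝ × ℝ)} {L R : ℝ}
    (h : SumApproxOne Γ (ellipseSymbol L R)) (z : ℝ × ℝ) : ∃ γ ∈ Γ, z ∈ ellipseAt L R γ := by
  obtain ⟨A, B, hA, -, h⟩ := h
  by_contra! hc
  have h0 : ∀ γ : Γ, ellipseSymbol L R γ z = 0 := fun γ => Set.indicator_of_notMem (hc γ γ.2) _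
  have := (h z).2.1
  simp only [h0, tsum_zero] at this
  linarith

/-- A bounded overlap of translated ellipses persists when the ellipses are enlarged. -/
theorem SumApproxOne.exists_tsum_indicator_le {Γ : Set (ℝ × ℝ)} {L R : ℝ} (hL : 0 < L) (hR : 0 < R)
    (h : SumApproxOne Γ (ellipseSymbol L R)) (ρ : ℝ) :
    ∃ B : ENNReal, B ≠ ⊤ ∧ ∀ z, ∑' γ : Γ, (ellipseAt L ρ γ).indicator 1 z ≤ B := by
  obtain ⟨A, B, hA, -, h⟩ := h
  have hB : ∀ z, ∑' γ : Γ, (ellipseAt L R γ).indicator (1 : ℝ × ℝ → ENNReal) z ≤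
      ENNReal.ofReal B := by
    intro z
    simp only [← ellipseSymbol_eq_indicator]
    rw [← ENNReal.ofReal_tsum_of_nonneg (fun γ : Γ => ellipseSymbol_nonneg L R γ z) (h z).1]
    exact ENNReal.ofReal_le_ofReal (h z).2.2
  -- Finitely many translates of the open ellipse of radius `R` cover the one of radius `ρ`, so the
  -- overlap at `z` is at most the sum of the original overlaps at the points `z - p`, `p ∈ t`.
  obtain ⟨t, ht⟩ := (isCompact_ellipse hL ρ).elim_finite_subcover
    (fun p : ℝ × ℝ => {z : ℝ × ℝ | L ^ 2 * (z - p).1 ^ 2 + (z - p).2 ^ 2 / L ^ 2 < R ^ 2})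
    (fun p => isOpen_lt (by fun_prop) continuous_const)
    (fun z _ => Set.mem_iUnion.mpr ⟨z, by simpa using pow_pos hR 2⟩)
  refine ⟨∑ _p ∈ t, ENNReal.ofReal B, by simp [ENNReal.mul_eq_top], fun z => ?_⟩
  calc ∑' γ : Γ, (ellipseAt L ρ γ).indicator (1 : ℝ × ℝ → ENNReal) z
      ≤ ∑' γ : Γ, ∑ p ∈ t, (ellipseAt L R γ).indicator (1 : ℝ × ℝ → ENNReal) (z - p) := by
        refine ENNReal.tsum_le_tsum fun γ => ?_
        by_cases hz : z ∈ ellipseAt L ρ γ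
        · obtain ⟨p, hp, hzp⟩ := Set.mem_iUnion₂.mp (ht hz)
          have hm : z - p ∈ ellipseAt L R γ := by
            have : z - p - γ = z - γ - p := by abel
            simp only [ellipseAt, ellipse, Set.mem_ofPred_eq, this]
            exact le_of_lt hzp
          rw [Set.indicator_of_mem hz]
          calc (1 : ENNReal) = (ellipseAt L R γ).indicator (1 : ℝ × ℝ → ENNReal) (z - p) := by
                rw [Set.indicator_of_mem hm]; rfl
            _ ≤ _ := Finset.single_le_sum
                (f := fun p => (ellipseAt L R γ).indicator (1 : ℝ × ℝ → ENNReal) (z - p))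
                (fun _ _ => zero_le) hp
        · rw [Set.indicator_of_notMem hz]
          exact zero_le
    _ = ∑ p ∈ t, ∑' γ : Γ, (ellipseAt L R γ).indicator (1 : ℝ × ℝ → ENNReal) (z - p) :=
        Summable.tsum_finsetSum fun _ _ => ENNReal.summable
    _ ≤ _ := Finset.sum_le_sum fun p _ => hB (z - p)

/-- Only countably many centres have an ellipse of given radius containing the origin, as the
overlap there is finite; integer radii exhaust `Γ`. Countability justifies exchanging sums with
integrals and measurability of unions. -/
theorem SumApproxOne.countable {Γ : Set (ℝ × ℝ)} {L R : ℝ} (hL : 0 < L) (hR : 0 < R)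
    (h : SumApproxOne Γ (ellipseSymbol L R)) : Γ.Countable := by
  rw [← Set.countable_coe_iff, ← Set.countable_univ_iff]
  have hc : ∀ n : ℕ, {γ : Γ | (0 : ℝ × ℝ) ∈ ellipseAt L n γ}.Countable := by
    intro n
    obtain ⟨B, hB, hle⟩ := h.exists_tsum_indicator_le hL hR n
    refine (Summable.countable_support_ennreal ((hle 0).trans_lt hB.lt_top).ne).mono fun γ hγ => ?_
    rw [Function.mem_support, Set.indicator_of_mem (show (0 : ℝ × ℝ) ∈ ellipseAt L n γ from hγ)]
    exact one_ne_zero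
  refine (Set.countable_iUnion hc).mono fun γ _ => ?_
  obtain ⟨n, hn⟩ := exists_nat_ge
    (L ^ 2 * ((0 : ℝ × ℝ) - γ).1 ^ 2 + ((0 : ℝ × ℝ) - γ).2 ^ 2 / L ^ 2)
  refine Set.mem_iUnion.mpr ⟨n + 1, ?_⟩
  simp only [ellipseAt, ellipse, Set.mem_ofPred_eq]
  refine hn.trans ?_
  push_cast
  nlinarith [(Nat.cast_nonneg n : (0 : ℝ) ≤ n)]

/-- Bessel-type bound for the energies on the translated ellipses. -/
theorem SumApproxOne.exists_tsum_lintegral_le {Γ : Set (ℝ × ℝ)} {L R : ℝ} (hL : 0 < L) (hR : 0 < R)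
    (h : SumApproxOne Γ (ellipseSymbol L R)) (ρ : ℝ) :
    ∃ B : ENNReal, B ≠ ⊤ ∧ ∀ σ ⊆ Γ, ∀ f : L2R,
      ∑' γ : σ, ∫⁻ z in ellipseAt L ρ γ, ‖stft (gaussianL2 L hL) f z‖ₑ ^ 2 ≤ B * ‖f‖ₑ ^ 2 := by
  obtain ⟨B, hB, hle⟩ := h.exists_tsum_indicator_le hL hR ρ
  have := (h.countable hL hR).to_subtype
  refine ⟨B, hB, fun σ hσ f => ?_⟩
  set V := fun z => ‖stft (gaussianL2 L hL) f z‖ₑ ^ 2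
  have hV : Measurable V := (stronglyMeasurable_stft (gaussianL2 L hL) f).measurable.enorm.pow_const 2
  calc ∑' γ : σ, ∫⁻ z in ellipseAt L ρ γ, V z
      ≤ ∑' γ : Γ, ∫⁻ z in ellipseAt L ρ γ, V z :=
        ENNReal.tsum_mono_subtype (fun γ => ∫⁻ z in ellipseAt L ρ γ, V z) hσ
    _ = ∑' γ : Γ, ∫⁻ z, (ellipseAt L ρ γ).indicator 1 z * V z := by
        refine tsum_congr fun γ => ?_
        rw [← lintegral_indicator (measurableSet_ellipseAt L ρ γ)]
        congr 1 with z
        by_cases hz : z ∈ ellipseAt L ρ γ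
        · simp [Set.indicator_of_mem hz]
        · simp [Set.indicator_of_notMem hz]
    _ = ∫⁻ z, ∑' γ : Γ, (ellipseAt L ρ γ).indicator 1 z * V z := by
        rw [lintegral_tsum]
        exact fun γ => ((measurable_one.indicator (measurableSet_ellipseAt L ρ γ)).mul hV).aemeasurable
    _ ≤ ∫⁻ z, B * V z := by
        refine lintegral_mono fun z => ?_
        rw [ENNReal.tsum_mul_right]
        exact mul_le_mul_left (hle z) _
    _ = B * ‖f‖ₑ ^ 2 := by
        rw [lintegral_const_mul _ hV, lintegral_enorm_stft_sq, ← ofReal_norm (gaussianL2 L hL),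
          norm_gaussianL2]
        simp

/-! ### Gluing two windows -/

theorem enorm_sq_le_two_mul_add (a b : ℂ) : ‖a‖ₑ ^ 2 ≤ 2 * ‖b‖ₑ ^ 2 + 2 * ‖a - b‖ₑ ^ 2 := by
  have h4 : ∀ w : ℂ, ‖w‖ₑ ^ 2 = ENNReal.ofReal (‖w‖ ^ 2) := fun w => by
    rw [ENNReal.ofReal_pow (norm_nonneg _), ofReal_norm]
  have h2 : (2 : ENNReal) = ENNReal.ofReal 2 := by simp
  rw [h4, h4, h4, h2, ← ENNReal.ofReal_mul (by norm_num), ← ENNReal.ofReal_mul (by norm_num),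
    ← ENNReal.ofReal_add (by positivity) (by positivity)]
  apply ENNReal.ofReal_le_ofReal
  have h5 : ‖a‖ ≤ ‖b‖ + ‖a - b‖ := by
    calc ‖a‖ = ‖b + (a - b)‖ := by rw [add_sub_cancel]
      _ ≤ _ := norm_add_le _ _
  nlinarith [norm_nonneg a, norm_nonneg b, norm_nonneg (a - b), sq_nonneg (‖b‖ - ‖a - b‖)]

/-- Gluing two short-time Fourier transforms with nearby windows along a set and its complement
does not lose energy. -/
theorem enorm_sq_le_four_mul_setLIntegral_stft {φ ψ : L2R} (hφ : ‖φ‖ = 1) (h : ‖φ - ψ‖ < 1 / 2)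
    {S : Set (ℝ × ℝ)} (hS : MeasurableSet S) (f : L2R) :
    ‖f‖ₑ ^ 2 ≤ 4 * ((∫⁻ z in S, ‖stft φ f z‖ₑ ^ 2) + ∫⁻ z in Sᶜ, ‖stft ψ f z‖ₑ ^ 2) := by
  have hV : ∀ χ : L2R, Measurable fun z => ‖stft χ f z‖ₑ ^ 2 := fun χ =>
    (stronglyMeasurable_stft χ f).measurable.enorm.pow_const 2
  set D := ∫⁻ z in Sᶜ, ‖stft (φ - ψ) f z‖ₑ ^ 2
  -- The threshold `1 / 2` enters here: the doubled error `2 * D` below is at most half of `‖f‖²`,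
  -- and absorbing it leaves a bound by twice the first integral plus four times the second.
  have hD : 4 * D ≤ ‖f‖ₑ ^ 2 := by
    have h1 : D ≤ ‖φ - ψ‖ₑ ^ 2 * ‖f‖ₑ ^ 2 := by
      rw [← lintegral_enorm_stft_sq]
      exact setLIntegral_le_lintegral _ _
    have h2 : 4 * ‖φ - ψ‖ₑ ^ 2 ≤ 1 := by
      have h4 : (4 : ENNReal) = ENNReal.ofReal 4 := by simp
      rw [← ofReal_norm, ← ENNReal.ofReal_pow (norm_nonneg _), h4,
        ← ENNReal.ofReal_mul (by norm_num), ENNReal.ofReal_le_one]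
      nlinarith [norm_nonneg (φ - ψ)]
    calc 4 * D ≤ 4 * (‖φ - ψ‖ₑ ^ 2 * ‖f‖ₑ ^ 2) := by gcongr
      _ = (4 * ‖φ - ψ‖ₑ ^ 2) * ‖f‖ₑ ^ 2 := by ring
      _ ≤ 1 * ‖f‖ₑ ^ 2 := by gcongr
      _ = _ := one_mul _
  have h1 : ‖f‖ₑ ^ 2 ≤ (∫⁻ z in S, ‖stft φ f z‖ₑ ^ 2) +
      (2 * (∫⁻ z in Sᶜ, ‖stft ψ f z‖ₑ ^ 2) + 2 * D) := by
    have hm := lintegral_enorm_stft_sq φ f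
    rw [← ofReal_norm φ, hφ, ENNReal.ofReal_one, one_pow, one_mul, ← lintegral_add_compl _ hS] at hm
    rw [← hm]
    gcongr
    rw [← lintegral_const_mul _ (hV ψ), ← lintegral_const_mul _ (hV (φ - ψ)),
      ← lintegral_add_left ((hV ψ).const_mul 2)]
    refine lintegral_mono fun z => ?_
    rw [stft_sub_left]
    exact enorm_sq_le_two_mul_add _ _
  generalize (∫⁻ z in S, ‖stft φ f z‖ₑ ^ 2) = A at *
  generalize (∫⁻ z in Sᶜ, ‖stft ψ f z‖ₑ ^ 2) = B at *
  clear_value D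
  have hX : ‖f‖ₑ ^ 2 ≠ ⊤ := by simp
  generalize ‖f‖ₑ ^ 2 = X at *
  have hD' : D ≠ ⊤ := by
    rintro rfl
    simp only [ENNReal.mul_top (show (4 : ENNReal) ≠ 0 by norm_num), top_le_iff] at hD
    exact hX hD
  by_cases hA : A = ⊤
  · simp [hA]
  by_cases hB : B = ⊤
  · simp [hB]
  lift A to NNReal using hA
  lift B to NNReal using hB
  lift D to NNReal using hD'
  lift X to NNReal using hX
  norm_cast at *
  rw [← NNReal.coe_le_coe] at *
  push_cast at *
  linarith [A.2, B.2]

/-- The adapted coordinates rescale by `b / a` and `a / b`; the sum dominates both factors. It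
transfers a covering by ellipses of one shape to the other shape. -/
theorem ellipse_subset_ellipse {a b R : ℝ} (ha : 0 < a) (hb : 0 < b) (hR : 0 < R) :
    ellipse a R ⊆ ellipse b (R * (b / a + a / b)) := by
  intro z hz
  simp only [ellipse, Set.mem_ofPred_eq] at hz ⊢
  have h1 : b ^ 2 * z.1 ^ 2 = (b / a) ^ 2 * (a ^ 2 * z.1 ^ 2) := by field_simp
  have h2 : z.2 ^ 2 / b ^ 2 = (a / b) ^ 2 * (z.2 ^ 2 / a ^ 2) := by field_simp
  have hx : 0 ≤ a ^ 2 * z.1 ^ 2 := by positivity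
  have hy : 0 ≤ z.2 ^ 2 / a ^ 2 := by positivity
  calc b ^ 2 * z.1 ^ 2 + z.2 ^ 2 / b ^ 2
      = (b / a) ^ 2 * (a ^ 2 * z.1 ^ 2) + (a / b) ^ 2 * (z.2 ^ 2 / a ^ 2) := by rw [← h1, ← h2]
    _ ≤ (b / a) ^ 2 * R ^ 2 + (a / b) ^ 2 * R ^ 2 := by
        gcongr <;> linarith
    _ ≤ (R * (b / a + a / b)) ^ 2 := by
        have : 0 ≤ R ^ 2 * ((b / a) * (a / b)) := by positivity
        nlinarith

/-! ### Frame bounds and truncation -/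

theorem isFrame_of_enorm {ι : Type*} {e : ι → L2R} {A : ℝ} {B : ENNReal} (hA : 0 < A) (hB : B ≠ ⊤)
    (hl : ∀ f : L2R, ENNReal.ofReal A * ‖f‖ₑ ^ 2 ≤ ∑' i, ‖inner ℂ f (e i)‖ₑ ^ 2)
    (hu : ∀ f : L2R, ∑' i, ‖inner ℂ f (e i)‖ₑ ^ 2 ≤ B * ‖f‖ₑ ^ 2) : IsFrame e := by
  -- The maximum secures the order of the two bounds without testing on a nonzero vector.
  refine ⟨A, max A B.toReal, hA, le_max_left _ _, fun f => ?_⟩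
  have hne : ∑' i, ‖inner ℂ f (e i)‖ₑ ^ 2 ≠ ⊤ :=
    ((hu f).trans_lt (ENNReal.mul_lt_top hB.lt_top (by simp))).ne
  have hs := ENNReal.summable_toReal hne
  have ht := ENNReal.tsum_toReal_eq (f := fun i => ‖inner ℂ f (e i)‖ₑ ^ 2)
    (fun i => ENNReal.ne_top_of_tsum_ne_top hne i)
  simp only [ENNReal.toReal_pow, toReal_enorm] at hs ht
  refine ⟨hs, ?_, ?_⟩
  · rw [← ht]
    have := ENNReal.toReal_mono hne (hl f)
    rwa [ENNReal.toReal_mul, ENNReal.toReal_ofReal hA.le, ENNReal.toReal_pow, toReal_enorm] at this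
  · rw [← ht]
    have := ENNReal.toReal_mono (ENNReal.mul_ne_top hB (by simp)) (hu f)
    rw [ENNReal.toReal_mul, ENNReal.toReal_pow, toReal_enorm] at this
    exact this.trans (mul_le_mul_of_nonneg_right (le_max_right _ _) (by positivity))

/-- The squared modulus of the Hermite coefficient of `f` at the time-frequency point `γ`. -/
def hermiteEnergy (L : ℝ) (hL : 0 < L) (f : L2R) (γ : ℝ × ℝ) (k : ℕ) : ENNReal :=
  ‖inner ℂ f (tfShift γ (hermiteL2 L hL k))‖ₑ ^ 2

theorem tsum_ellipseEigenvalue_mul_hermiteEnergy {L : ℝ} (hL : 0 < L) {R : ℝ} (hR : 0 < R)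
    (γ : ℝ × ℝ) (f : L2R) :
    ∑' k, ENNReal.ofReal (ellipseEigenvalue R k) * hermiteEnergy L hL f γ k =
      ∫⁻ z in ellipseAt L R γ, ‖stft (gaussianL2 L hL) f z‖ₑ ^ 2 :=
  tsum_ellipseEigenvalue_mul hL hR γ f

/-- Finitely many indices have eigenvalues at least `λ_M(R) > 0`, so each coefficient sum is at most
`1 / λ_M(R)` times a local energy, and the local energies obey a Bessel bound. -/
theorem SumApproxOne.exists_tsum_hermiteEnergy_le {Γ : Set (ℝ × ℝ)} {L R : ℝ} (hL : 0 < L)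
    (hR : 0 < R) (h : SumApproxOne Γ (ellipseSymbol L R)) {K : Type*} [Finite K] {e : K → ℕ}
    (he : Function.Injective e) :
    ∃ B : ENNReal, B ≠ ⊤ ∧ ∀ σ ⊆ Γ, ∀ f : L2R,
      ∑' γ : σ, ∑' k, hermiteEnergy L hL f γ (e k) ≤ B * ‖f‖ₑ ^ 2 := by
  obtain ⟨B, hB, hle⟩ := h.exists_tsum_lintegral_le hL hR R
  obtain ⟨M, hM⟩ := (Set.finite_range e).bddAbove
  have hpos : ENNReal.ofReal (ellipseEigenvalue R M) ≠ 0 := by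
    simpa using ellipseEigenvalue_pos hR M
  set l := ENNReal.ofReal (ellipseEigenvalue R M) with hl
  refine ⟨l⁻¹ * B, ENNReal.mul_ne_top (ENNReal.inv_ne_top.mpr hpos) hB, fun σ hσ f => ?_⟩
  calc ∑' γ : σ, ∑' k, hermiteEnergy L hL f γ (e k)
      ≤ ∑' γ : σ, l⁻¹ * ∫⁻ z in ellipseAt L R γ, ‖stft (gaussianL2 L hL) f z‖ₑ ^ 2 := by
        refine ENNReal.tsum_le_tsum fun γ => ?_
        rw [← tsum_ellipseEigenvalue_mul_hermiteEnergy hL hR, ← ENNReal.tsum_mul_left]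
        refine le_trans (ENNReal.tsum_le_tsum fun k => ?_) (ENNReal.tsum_comp_le_tsum_of_injective he _)
        have hk : l ≤ ENNReal.ofReal (ellipseEigenvalue R (e k)) :=
          ENNReal.ofReal_le_ofReal ((strictAnti_ellipseEigenvalue hR).antitone (hM ⟨k, rfl⟩))
        rw [← mul_assoc]
        refine le_mul_of_one_le_left zero_le ?_
        rw [← ENNReal.inv_mul_cancel hpos ENNReal.ofReal_ne_top]
        gcongr
    _ = l⁻¹ * ∑' γ : σ, ∫⁻ z in ellipseAt L R γ, ‖stft (gaussianL2 L hL) f z‖ₑ ^ 2 :=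
        ENNReal.tsum_mul_left
    _ ≤ l⁻¹ * (B * ‖f‖ₑ ^ 2) := by gcongr; exact hle σ hσ f
    _ = _ := by ring

theorem exists_ellipseEigenvalue_le_mul (ρ : ℝ) {d : ℝ} (hd : 0 < d) :
    ∃ N : ℕ, ∀ k, N ≤ k → ellipseEigenvalue ρ k ≤ d * ellipseEigenvalue (2 * ρ) k := by
  have h : Filter.Tendsto (fun k : ℕ => Real.exp (3 * (Real.pi * ρ ^ 2)) * (1 / 4 : ℝ) ^ (k + 1))
      Filter.atTop (nhds 0) := by
    have h1 := (tendsto_pow_atTop_nhds_zero_of_lt_one (r := (1 / 4 : ℝ)) (by norm_num)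
      (by norm_num))
    have h2 := ((Filter.tendsto_add_atTop_iff_nat 1).mpr h1).const_mul
      (Real.exp (3 * (Real.pi * ρ ^ 2)))
    rwa [mul_zero] at h2
  obtain ⟨N, hN⟩ := Filter.eventually_atTop.mp (h.eventually_le_const hd)
  exact ⟨N, fun k hk => (ellipseEigenvalue_le_mul_ellipseEigenvalue_two_mul ρ k).trans
    (mul_le_mul_of_nonneg_right (hN k hk) (ellipseEigenvalue_nonneg _ _))⟩

/-- Up to a small multiple of the energy on a larger ellipse, the energy on an ellipse is captured
by finitely many Hermite coefficients. -/
theorem setLIntegral_stft_le_sum_hermiteEnergy_add {L : ℝ} (hL : 0 < L) {ρ d : ℝ} (hρ : 0 < ρ)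
    (hd : 0 < d) {N : ℕ}
    (hN : ∀ k, N ≤ k → ellipseEigenvalue ρ k ≤ d * ellipseEigenvalue (2 * ρ) k)
    (γ : ℝ × ℝ) (f : L2R) :
    ∫⁻ z in ellipseAt L ρ γ, ‖stft (gaussianL2 L hL) f z‖ₑ ^ 2 ≤
      (∑ k ∈ Finset.range N, hermiteEnergy L hL f γ k) + ENNReal.ofReal d *
        ∫⁻ z in ellipseAt L (2 * ρ) γ, ‖stft (gaussianL2 L hL) f z‖ₑ ^ 2 := by
  rw [← tsum_ellipseEigenvalue_mul_hermiteEnergy hL hρ,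
    ← tsum_ellipseEigenvalue_mul_hermiteEnergy hL (by positivity : 0 < 2 * ρ),
    ← ENNReal.tsum_mul_left]
  have hs : ∑ k ∈ Finset.range N, hermiteEnergy L hL f γ k =
      ∑' k, if k < N then hermiteEnergy L hL f γ k else 0 := by
    rw [tsum_eq_sum (s := Finset.range N) fun k hk => if_neg (by simpa using hk)]
    exact Finset.sum_congr rfl fun k hk => (if_pos (Finset.mem_range.mp hk)).symm
  rw [hs, ← ENNReal.tsum_add]
  refine ENNReal.tsum_le_tsum fun k => ?_
  -- Below `N` the eigenvalue is at most `1`; from `N` on it is traded for `d` times the eigenvalue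
  -- of the doubled ellipse.
  split_ifs with hk
  · refine le_add_right ?_
    refine mul_le_of_le_one_left zero_le ?_
    rw [ENNReal.ofReal_le_one]
    exact ellipseEigenvalue_le_one ρ k
  · rw [zero_add, ← mul_assoc, ← ENNReal.ofReal_mul hd.le]
    gcongr
    exact hN k (not_lt.mp hk)

/-! ### Weaving -/

/-- The uniform lower bound for all weavings. -/
theorem exists_le_tsum_hermiteEnergy (L : Fin 2 → ℝ) (hL : ∀ i, 0 < L i)
    (hφ : ‖gaussianL2 (L 0) (hL 0) - gaussianL2 (L 1) (hL 1)‖ < 1 / 2) {Γ : Set (ℝ × ℝ)} {R : ℝ}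
    (hR : 0 < R) (hΓ : ∀ i, SumApproxOne Γ (ellipseSymbol (L i) R)) :
    ∃ N : ℕ, ∀ σ : Fin 2 → Set (ℝ × ℝ), ⋃ j, σ j = Γ → ∀ f : L2R,
      ‖f‖ₑ ^ 2 ≤ 8 * ∑ i, ∑' γ : σ i, ∑ k ∈ Finset.range N, hermiteEnergy (L i) (hL i) f γ k := by
  -- Radii for which ellipses of either shape contain the `L 0`-ellipse of radius `R`, so that one
  -- covering serves both windows.
  set ρ : Fin 2 → ℝ := fun i => R * (L i / L 0 + L 0 / L i) with hρdef
  have hρ : ∀ i, 0 < ρ i := fun i => by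
    have := hL i
    have := hL 0
    simp only [hρdef]
    positivity
  have hsub : ∀ i γ, ellipseAt (L 0) R γ ⊆ ellipseAt (L i) (ρ i) γ := fun i γ z hz =>
    ellipse_subset_ellipse (hL 0) (hL i) hR hz
  choose B hB hle using fun i => (hΓ i).exists_tsum_lintegral_le (hL i) hR (2 * ρ i)
  -- Chosen so that the tail, after multiplication by the gluing constant `4`, is at most half of
  -- `‖f‖²`; the `+ 1` keeps the denominator positive.
  set d : ℝ := 1 / (8 * ((∑ i, B i).toReal + 1)) with hddef
  have hd : 0 < d := by positivity
  have hBsum : ∑ i, B i ≠ ⊤ := by simp [hB]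
  have hdB : 8 * (ENNReal.ofReal d * ∑ i, B i) ≤ 1 := by
    rw [← ENNReal.ofReal_toReal hBsum, ← ENNReal.ofReal_mul hd.le,
      show (8 : ENNReal) = ENNReal.ofReal 8 by simp, ← ENNReal.ofReal_mul (by norm_num),
      ENNReal.ofReal_le_one, hddef]
    have : 0 ≤ (∑ i, B i).toReal := ENNReal.toReal_nonneg
    rw [one_div, ← div_eq_inv_mul, mul_div_assoc', div_le_one (by positivity)]
    linarith
  choose N hN using fun i => exists_ellipseEigenvalue_le_mul (ρ i) hd
  refine ⟨∑ i, N i, fun σ hσ f => ?_⟩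
  have hσΓ : ∀ i, σ i ⊆ Γ := fun i => hσ ▸ Set.subset_iUnion σ i
  have hcount : ∀ i, Countable (σ i) := fun i =>
    (((hΓ 0).countable (hL 0) hR).mono (hσΓ i)).to_subtype
  set V : Fin 2 → ℝ × ℝ → ENNReal := fun i z => ‖stft (gaussianL2 (L i) (hL i)) f z‖ₑ ^ 2 with hV
  have hglue : ‖f‖ₑ ^ 2 ≤ 4 * ∑ i, ∑' γ : σ i, ∫⁻ z in ellipseAt (L i) (ρ i) γ, V i z := by
    -- Every point lies in an ellipse centred in `Γ`, hence in `U 0` or `U 1`; the windows are glued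
    -- along `U 0` and its complement.
    set U : Fin 2 → Set (ℝ × ℝ) := fun i => ⋃ γ : σ i, ellipseAt (L i) (ρ i) γ with hU
    have hUm : MeasurableSet (U 0) := MeasurableSet.iUnion fun γ => measurableSet_ellipseAt _ _ _
    have hUc : (U 0)ᶜ ⊆ U 1 := by
      intro z hz
      obtain ⟨γ, hγ, hzγ⟩ := (hΓ 0).exists_mem_ellipseAt z
      rw [← hσ] at hγ
      obtain ⟨i, hi⟩ := Set.mem_iUnion.mp hγ
      have hzi : z ∈ U i := Set.mem_iUnion.mpr ⟨⟨γ, hi⟩, hsub i γ hzγ⟩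
      fin_cases i
      · exact absurd hzi hz
      · exact hzi
    refine (enorm_sq_le_four_mul_setLIntegral_stft (norm_gaussianL2 _ _) hφ hUm f).trans ?_
    rw [Fin.sum_univ_two]
    gcongr
    · exact lintegral_iUnion_le _ _
    · exact (lintegral_mono_set hUc).trans (lintegral_iUnion_le _ _)
  have htail : ∑ i, ∑' γ : σ i, ∫⁻ z in ellipseAt (L i) (ρ i) γ, V i z ≤
      (∑ i, ∑' γ : σ i, ∑ k ∈ Finset.range (∑ i, N i), hermiteEnergy (L i) (hL i) f γ k) +
        ENNReal.ofReal d * (∑ i, B i) * ‖f‖ₑ ^ 2 := by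
    rw [mul_assoc, Finset.sum_mul, Finset.mul_sum, ← Finset.sum_add_distrib]
    refine Finset.sum_le_sum fun i _ => ?_
    have hi : ∑' γ : σ i, ∫⁻ z in ellipseAt (L i) (2 * ρ i) γ, V i z ≤ B i * ‖f‖ₑ ^ 2 :=
      hle i (σ i) (hσΓ i) f
    calc ∑' γ : σ i, ∫⁻ z in ellipseAt (L i) (ρ i) γ, V i z
        ≤ ∑' γ : σ i, ((∑ k ∈ Finset.range (∑ i, N i), hermiteEnergy (L i) (hL i) f γ k) +
          ENNReal.ofReal d * ∫⁻ z in ellipseAt (L i) (2 * ρ i) γ, V i z) :=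
          ENNReal.tsum_le_tsum fun γ => setLIntegral_stft_le_sum_hermiteEnergy_add (hL i) (hρ i) hd
            (fun k hk => hN i k ((Finset.single_le_sum (fun _ _ => Nat.zero_le _)
              (Finset.mem_univ i)).trans hk)) γ f
      _ = (∑' γ : σ i, ∑ k ∈ Finset.range (∑ i, N i), hermiteEnergy (L i) (hL i) f γ k) +
          ENNReal.ofReal d * ∑' γ : σ i, ∫⁻ z in ellipseAt (L i) (2 * ρ i) γ, V i z := by
          rw [ENNReal.tsum_add, ENNReal.tsum_mul_left]
      _ ≤ _ := by gcongr
  have hD : 8 * (ENNReal.ofReal d * (∑ i, B i) * ‖f‖ₑ ^ 2) ≤ ‖f‖ₑ ^ 2 := by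
    rw [← mul_assoc]
    exact mul_le_of_le_one_left zero_le hdB
  have hDtop : ENNReal.ofReal d * (∑ i, B i) * ‖f‖ₑ ^ 2 ≠ ⊤ :=
    ENNReal.mul_ne_top (ENNReal.mul_ne_top ENNReal.ofReal_ne_top hBsum) (by simp)
  have hX : ‖f‖ₑ ^ 2 ≠ ⊤ := by simp
  have hfin := hglue.trans (mul_le_mul_right htail 4)
  clear hglue htail
  generalize (∑ i, ∑' γ : σ i, ∑ k ∈ Finset.range (∑ i, N i),
    hermiteEnergy (L i) (hL i) f γ k) = S at *
  generalize ENNReal.ofReal d * (∑ i, B i) * ‖f‖ₑ ^ 2 = D at *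
  generalize ‖f‖ₑ ^ 2 = X at *
  by_cases hS : S = ⊤
  · simp [hS]
  clear_value d ρ
  clear hdB hddef hV
  lift S to NNReal using hS
  lift D to NNReal using hDtop
  lift X to NNReal using hX
  norm_cast at hfin hD ⊢
  rw [← NNReal.coe_le_coe] at hfin hD ⊢
  push_cast at hfin hD ⊢
  linarith

/-- Sufficiently many Hermite functions generate woven multi-window Gabor frames. -/
theorem exists_isWoven_hermiteL2 (L : Fin 2 → ℝ) (hL : ∀ i, 0 < L i)
    (hφ : ‖gaussianL2 (L 0) (hL 0) - gaussianL2 (L 1) (hL 1)‖ < 1 / 2) {Γ : Set (ℝ × ℝ)} {R : ℝ}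
    (hR : 0 < R) (hΓ : ∀ i, SumApproxOne Γ (ellipseSymbol (L i) R)) :
    ∃ N : ℕ, ∀ (K : Type) [Finite K] (e : K → ℕ), Function.Injective e →
      (∀ k < N, k ∈ Set.range e) →
      IsWoven (fun (i : Fin 2) (k : K) => hermiteL2 (L i) (hL i) (e k)) Γ := by
  obtain ⟨N, hN⟩ := exists_le_tsum_hermiteEnergy L hL hφ hR hΓ
  refine ⟨N, fun K _ e he hrange => ?_⟩
  choose B hB hle using fun i => (hΓ i).exists_tsum_hermiteEnergy_le (hL i) hR he
  have hlower : ∀ σ : Fin 2 → Set (ℝ × ℝ), ⋃ j, σ j = Γ → ∀ f : L2R,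
      ENNReal.ofReal (1 / 8) * ‖f‖ₑ ^ 2 ≤
        ∑ i, ∑' γ : σ i, ∑' k, hermiteEnergy (L i) (hL i) f γ (e k) := by
    intro σ hσ f
    have h8 : ENNReal.ofReal (1 / 8) * 8 = 1 := by
      rw [show (8 : ENNReal) = ENNReal.ofReal 8 by simp, ← ENNReal.ofReal_mul (by norm_num)]
      norm_num
    calc ENNReal.ofReal (1 / 8) * ‖f‖ₑ ^ 2
        ≤ ENNReal.ofReal (1 / 8) * (8 * ∑ i, ∑' γ : σ i, ∑ k ∈ Finset.range N,
          hermiteEnergy (L i) (hL i) f γ k) := by gcongr; exact hN σ hσ f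
      _ = ∑ i, ∑' γ : σ i, ∑ k ∈ Finset.range N, hermiteEnergy (L i) (hL i) f γ k := by
          rw [← mul_assoc, h8, one_mul]
      _ ≤ _ := by
          refine Finset.sum_le_sum fun i _ => ENNReal.tsum_le_tsum fun γ => ?_
          rw [← tsum_range (fun k => hermiteEnergy (L i) (hL i) f γ k) he,
            ← Finset.tsum_subtype (Finset.range N)]
          exact ENNReal.tsum_mono_subtype (fun k => hermiteEnergy (L i) (hL i) f γ k)
            fun k hk => hrange k (Finset.mem_range.mp hk)
  refine ⟨fun j => ?_, fun σ _ hσ => ?_⟩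
  · refine isFrame_of_enorm (A := 1 / 8) (B := B j) (by norm_num) (hB j) (fun f => ?_) (fun f => ?_)
    · rw [ENNReal.tsum_prod']
      -- A single system is the weaving whose other part is empty.
      refine (hlower (fun i => if i = j then Γ else ∅) ?_ f).trans_eq ?_
      · ext γ
        simp
      · rw [Finset.sum_eq_single j]
        · rw [if_pos rfl]
          rfl
        · intro i _ hij
          simp [hij]
        · simp
    · rw [ENNReal.tsum_prod']
      exact hle j Γ subset_rfl f
  · refine isFrame_of_enorm (A := 1 / 8) (B := ∑ i, B i) (by norm_num) (by simp [hB])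
      (fun f => ?_) (fun f => ?_)
    · rw [ENNReal.tsum_sigma', tsum_fintype]
      simp only [ENNReal.tsum_prod']
      exact hlower σ hσ f
    · rw [ENNReal.tsum_sigma', tsum_fintype, Finset.sum_mul]
      refine Finset.sum_le_sum fun i _ => ?_
      rw [ENNReal.tsum_prod']
      exact hle i (σ i) (hσ ▸ Set.subset_iUnion σ i) f

theorem finite_setOf_lt_ellipseEigenvalue (R : ℝ) {ε : ℝ} (hε : 0 < ε) :
    {k : ℕ | ε < ellipseEigenvalue R k}.Finite := by
  obtain ⟨N, hN⟩ := Filter.eventually_atTop.mp ((tendsto_ellipseEigenvalue R).eventually_lt_const hε)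
  refine (Set.finite_lt_nat N).subset fun k hk => ?_
  by_contra h
  exact lt_asymm hk (hN k (not_lt.mp h))

end

theorem mainTheorem5 (L : Fin 2 → ℝ) (hL : ∀ i, 0 < L i) :
    -- the distance of the two dilated Gaussians
    ‖gaussianL2 (L 0) (hL 0) - gaussianL2 (L 1) (hL 1)‖ ^ 2 =
        2 - 2 * (√(2 * L 0 * L 1) / √(L 0 ^ 2 + L 1 ^ 2)) ∧
    (‖gaussianL2 (L 0) (hL 0) - gaussianL2 (L 1) (hL 1)‖ < 1 / 2 ↔
        (64 - √1695) / 49 < L 1 / L 0 ∧ L 1 / L 0 < (64 + √1695) / 49) ∧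
    -- the dilated Hermite functions are an orthonormal basis, and their time-frequency shifts
    -- are precisely the eigenfunctions of the localization operators on translated ellipses
    (∀ i, Orthonormal ℂ (hermiteL2 (L i) (hL i)) ∧
        (Submodule.span ℂ (Set.range (hermiteL2 (L i) (hL i)))).topologicalClosure = ⊤ ∧
        ∀ R : ℝ, 0 < R → ∀ (γ : ℝ × ℝ) (f : L2R) (μ : ℂ),
          (f ≠ 0 ∧
            localizationOp (ellipseSymbol (L i) R γ) (gaussianL2 (L i) (hL i)) f = μ • f) ↔
          ∃ k : ℕ, μ = (ellipseEigenvalue R k : ℂ) ∧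
            ∃ c : ℂ, c ≠ 0 ∧ f = c • tfShift γ (hermiteL2 (L i) (hL i) k)) ∧
    -- weaving
    ((64 - √1695) / 49 < L 1 / L 0 → L 1 / L 0 < (64 + √1695) / 49 →
      ∀ (Γ : Set (ℝ × ℝ)) (R : ℝ), 0 < R →
        (∀ i, SumApproxOne Γ (ellipseSymbol (L i) R)) →
        -- all eigenfunctions with eigenvalue above a small threshold
        (∃ ε₀ : ℝ, 0 < ε₀ ∧ ∀ ε : ℝ, 0 < ε → ε ≤ ε₀ →
          {k : ℕ | ε < ellipseEigenvalue R k}.Finite ∧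
          IsWoven (fun (i : Fin 2) (k : {k : ℕ | ε < ellipseEigenvalue R k}) =>
            hermiteL2 (L i) (hL i) k) Γ) ∧
        -- sufficiently many Hermite functions
        (∃ N : ℕ, ∀ n : ℕ, N ≤ n →
          IsWoven (fun (i : Fin 2) (k : Fin n) => hermiteL2 (L i) (hL i) k) Γ)) := by
  refine ⟨norm_gaussianL2_sub_sq _ _ _ _, norm_gaussianL2_sub_lt_iff _ _ _ _, fun i =>
    ⟨orthonormal_hermiteL2 _ _, closure_span_hermiteL2 _ _, fun R hR γ f μ =>
      localizationOp_eigen_iff (hL i) hR γ f μ⟩, fun h₁ h₂ Γ R hR hΓ => ?_⟩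
  obtain ⟨N, hN⟩ := exists_isWoven_hermiteL2 L hL
    ((norm_gaussianL2_sub_lt_iff _ _ (hL 0) (hL 1)).mpr ⟨h₁, h₂⟩) hR hΓ
  constructor
  · refine ⟨ellipseEigenvalue R N, ellipseEigenvalue_pos hR N, fun ε hε hle => ?_⟩
    have hfin := finite_setOf_lt_ellipseEigenvalue R hε
    have := hfin.to_subtype
    refine ⟨hfin, hN _ (fun k : {k : ℕ | ε < ellipseEigenvalue R k} => (k : ℕ))
      Subtype.val_injective fun k hk => ?_⟩
    exact ⟨⟨k, hle.trans_lt (strictAnti_ellipseEigenvalue hR hk)⟩, rfl⟩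
  · exact ⟨N, fun n hn => hN (Fin n) (fun k => (k : ℕ)) Fin.val_injective fun k hk =>
      ⟨⟨k, hk.trans_le hn⟩, rfl⟩⟩
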